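/- Let $K$ be an infinite field, let $S=K[x_1,\dots,x_m,y_1,\dots,y_n]$ be the polynomial ring with the standard bigrading $\deg x_i=(1,0)$, $\deg y_j=(0,1)$, and let $Q=(y_1,\dots,y_n)$. For a finitely generated bigraded ($\mathbb Z\times\mathbb Z$-graded) $S$-module $N$ let $H^i_Q(N)$ denote the $i$-th local cohomology module of $N$ with support in $Q$, let $\operatorname{cd}(Q,N)$ be the largest $i$ with $H^i_Q(N)\neq 0$ (and $-\infty$ if there is no such $i$), and let $\operatorname{grade}(Q,N)$ be the supremum of the lengths of $N$-regular sequences contained in $Q$ (and $\infty$ if $QN=N$). The module $N$ is called Cohen--Macaulay with respect to $Q$ if there is an integer $q$ such that $H^i_Q(N)=0$ for all $i\neq q$, and sequentially Cohen--Macaulay with respect to $Q$ if it has a finite filtration $$0=N_0\subsetneq N_1\subsetneq\dots\subsetneq N_r=N$$ by bigraded submodules such that each quotient $N_i/N_{i-1}$ is Cohen--Macaulay with respect to $Q$ and $$0\le \operatorname{cd}(Q,N_1/N_0)<\operatorname{cd}(Q,N_2/N_1)<\dots<\operatorname{cd}(Q,N_r/N_{r-1}).$$ Let $M$ be a finitely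 generated bigraded $S$-module with $\operatorname{grade}(Q,M)>0$. If $M$ is sequentially Cohen--Macaulay with respect to $Q$, then there exists a bihomogeneous $M$-regular element $y\in Q$ of degree $(0,1)$ (that is, an element $y \in Q$ of the component $S_{(0,1)}$ which is a nonzerodivisor on $M$) such that $M/yM$, with the induced bigrading, is sequentially Cohen--Macaulay with respect to $Q$. -/

import Mathlib

open scoped Pointwise

universe u

namespace BigradedCM

/-- The polynomial ring `S = K[x₁, …, x_m, y₁, …, y_n]`; `Sum.inl i` indexes `x_i` and `Sum.inr j`
indexes `y_j`. -/
abbrev S (K : Type u) [Field K] (m n : ℕ) : Type u := MvPolynomial (Fin m ⊕ Fin n) K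

/-- The standard bidegrees `deg x_i = (1, 0)`, `deg y_j = (0, 1)`. -/
def bidegree (m n : ℕ) : Fin m ⊕ Fin n → ℤ × ℤ :=
  Sum.elim (fun _ => (1, 0)) (fun _ => (0, 1))

variable (K : Type u) [Field K] (m n : ℕ)

/-- The bihomogeneous component `S_d` of `S`, for `d ∈ ℤ × ℤ`. -/
noncomputable abbrev component (d : ℤ × ℤ) : Submodule K (S K m n) :=
  MvPolynomial.weightedHomogeneousSubmodule K (bidegree m n) d

/-- The irrelevant ideal `Q = (y₁, …, y_n)`. -/
noncomputable def Q : Ideal (S K m n) :=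
  Ideal.span (Set.range fun j : Fin n => MvPolynomial.X (Sum.inr j))

section Bigraded

variable {M : Type u} [AddCommGroup M] [Module (S K m n) M]

/-- `M = ⨁_{d ∈ ℤ × ℤ} ℳ d` as an abelian group and `S_d · ℳ e ⊆ ℳ (d + e)`:
the family `ℳ` makes `M` a bigraded `S`-module. -/
structure IsBigrading (ℳ : ℤ × ℤ → AddSubgroup M) : Prop where
  internal : DirectSum.IsInternal ℳ
  smul_mem : ∀ ⦃d e : ℤ × ℤ⦄ ⦃f : S K m n⦄ ⦃z : M⦄,
    f ∈ component K m n d → z ∈ ℳ e → f • z ∈ ℳ (d + e)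

variable {K m n}

/-- `N` is a bigraded submodule of `M`: it is the sum of its subgroups `N ∩ ℳ d`. -/
def IsBigradedSubmodule (ℳ : ℤ × ℤ → AddSubgroup M) (N : Submodule (S K m n) M) : Prop :=
  N.toAddSubgroup = ⨆ d, ℳ d ⊓ N.toAddSubgroup

/-- The induced bigrading of a quotient `M / N`: its component of degree `d` is the image
of `ℳ d`. -/
noncomputable def quotientBigrading (ℳ : ℤ × ℤ → AddSubgroup M) (N : Submodule (S K m n) M) :
    ℤ × ℤ → AddSubgroup (M ⧸ N) :=
  fun d => (ℳ d).map N.mkQ.toAddMonoidHom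

/-- The induced family on the quotient by a bigraded submodule is again a bigrading. -/
theorem IsBigrading.quotient {ℳ : ℤ × ℤ → AddSubgroup M} (h : IsBigrading K m n ℳ)
    {N : Submodule (S K m n) M} (hN : IsBigradedSubmodule ℳ N) :
    IsBigrading K m n (quotientBigrading ℳ N) := by
  classical
  refine ⟨?_, ?_⟩
  · let D : DirectSum.Decomposition ℳ := h.internal.chooseDecomposition
    let φ : ∀ d, ℳ d →+ quotientBigrading ℳ N d := fun d =>
      (N.mkQ.toAddMonoidHom.comp (ℳ d).subtype).codRestrict _
        (fun x => ⟨x.1, x.2, rfl⟩)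
    let Ψ : M →+ DirectSum (ℤ × ℤ) (fun d => quotientBigrading ℳ N d) :=
      (DirectSum.map φ).comp (DirectSum.decomposeAddEquiv ℳ).toAddMonoidHom
    have hΨ : ∀ d (x : M) (hx : x ∈ ℳ d), Ψ x = DirectSum.of _ d (φ d ⟨x, hx⟩) := by
      intro d x hx
      change DirectSum.map φ (DirectSum.decompose ℳ x) = _
      rw [DirectSum.decompose_of_mem ℳ hx, DirectSum.map_of]
    have hker : N.toAddSubgroup ≤ Ψ.ker := by
      rw [hN]
      refine iSup_le fun d x hx => ?_
      rw [AddMonoidHom.mem_ker, hΨ d x hx.1]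
      have : φ d ⟨x, hx.1⟩ = 0 := by
        apply Subtype.ext
        exact (Submodule.Quotient.mk_eq_zero N).2 hx.2
      rw [this, map_zero]
    let Ψ' : (M ⧸ N) →+ DirectSum (ℤ × ℤ) (fun d => quotientBigrading ℳ N d) :=
      QuotientAddGroup.lift N.toAddSubgroup Ψ hker
    have hΨ' : ∀ x : M, Ψ' (N.mkQ x) = Ψ x := fun x => rfl
    have hleft : ∀ z, Ψ' (DirectSum.coeAddMonoidHom (quotientBigrading ℳ N) z) = z := by
      intro z
      induction z using DirectSum.induction_on with
      | zero => simp
      | of d z =>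
        obtain ⟨z, x, hx, rfl⟩ := z
        rw [DirectSum.coeAddMonoidHom_of]
        exact hΨ d x hx
      | add a b ha hb => rw [map_add, map_add, ha, hb]
    refine ⟨Function.LeftInverse.injective hleft, fun z => ?_⟩
    obtain ⟨x, rfl⟩ := N.mkQ_surjective z
    refine ⟨Ψ x, ?_⟩
    induction x using DirectSum.Decomposition.inductionOn ℳ with
    | zero => simp
    | homogeneous x => rw [hΨ _ x.1 x.2, DirectSum.coeAddMonoidHom_of]; rfl
    | add a b ha hb => rw [map_add, map_add, ha, hb, map_add]
  · rintro d e f _ hf ⟨x, hx, rfl⟩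
    exact ⟨f • x, h.smul_mem hf hx, N.mkQ.map_smul f x⟩

/-- The submodule `yM` is bigraded if `y` is bihomogeneous. -/
theorem IsBigrading.isBigradedSubmodule_smul_top {ℳ : ℤ × ℤ → AddSubgroup M}
    (h : IsBigrading K m n ℳ) {d : ℤ × ℤ} {y : S K m n} (hy : y ∈ component K m n d) :
    IsBigradedSubmodule ℳ (y • (⊤ : Submodule (S K m n) M)) := by
  classical
  refine le_antisymm ?_ (iSup_le fun e => inf_le_right)
  let D : DirectSum.Decomposition ℳ := h.internal.chooseDecomposition
  rintro _ ⟨x, -, rfl⟩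
  induction x using DirectSum.Decomposition.inductionOn ℳ with
  | zero => simp
  | @homogeneous e x =>
    exact AddSubgroup.mem_iSup_of_mem (d + e)
      ⟨h.smul_mem hy x.2, Submodule.smul_mem_pointwise_smul _ _ _ trivial⟩
  | add a b ha hb => rw [map_add]; exact add_mem ha hb

end Bigraded

section Invariants

variable {R : Type u} [CommRing R] (I : Ideal R) (M : Type u) [AddCommGroup M] [Module R M]

/-- The local cohomology module `H^i_I(M)`. -/
noncomputable abbrev H (i : ℕ) : ModuleCat.{u} R :=
  (localCohomology I i).obj (ModuleCat.of R M)

/-- The cohomological dimension `cd(I, M)`: the supremum of all `i` with `H^i_I(M) ≠ 0`;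
it is `⊥` if there is no such `i`. -/
noncomputable def cd : WithBot ℕ∞ :=
  ⨆ i ∈ {i : ℕ | Nontrivial (H I M i)}, ((i : ℕ∞) : WithBot ℕ∞)

/-- `grade(I, M)`: the supremum of the lengths of the `M`-regular sequences contained in `I`,
the condition `(a₁, …, a_k)M ≠ M` not being imposed. For a finitely generated module `M` over
a Noetherian ring with `IM ≠ M` that condition holds automatically, and if `IM = M` (for instance
if `M = 0`) the value is `⊤`, which is the usual convention. -/
noncomputable def grade : ℕ∞ :=
  ⨆ as ∈ {as : List R | (∀ a ∈ as, a ∈ I) ∧ RingTheory.Sequence.IsWeaklyRegular M as},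
    (as.length : ℕ∞)

/-- `M` is (relative) Cohen--Macaulay with respect to `I`: for some `q`, `H^i_I(M) = 0` for
all `i ≠ q`. -/
def IsRelativeCM : Prop :=
  ∃ q : ℤ, ∀ i : ℕ, (i : ℤ) ≠ q → Subsingleton (H I M i)

end Invariants

section Filtration

variable {K m n}
variable {M : Type u} [AddCommGroup M] [Module (S K m n) M]

/-- The quotient `M_{i+1} / M_i` of consecutive members of a chain of submodules. -/
abbrev factor {r : ℕ} (F : Fin (r + 1) → Submodule (S K m n) M) (i : Fin r) : Type u :=
  ↥(F i.succ) ⧸ (F i.castSucc).submoduleOf (F i.succ)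

/-- `0 = M_0 ⊊ M_1 ⊊ ⋯ ⊊ M_r = M` is a Cohen--Macaulay filtration of the bigraded module
`(M, ℳ)` with respect to `Q`. -/
structure IsCMFiltration (ℳ : ℤ × ℤ → AddSubgroup M) {r : ℕ}
    (F : Fin (r + 1) → Submodule (S K m n) M) : Prop where
  bot : F 0 = ⊥
  top : F (Fin.last r) = ⊤
  strict : ∀ i : Fin r, F i.castSucc < F i.succ
  bigraded : ∀ i, IsBigradedSubmodule ℳ (F i)
  relativeCM : ∀ i : Fin r, IsRelativeCM (Q K m n) (factor F i)
  cd_nonneg : ∀ i : Fin r, 0 ≤ cd (Q K m n) (factor F i)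
  cd_strictMono : StrictMono fun i : Fin r => cd (Q K m n) (factor F i)

variable (K m n) in
/-- The bigraded module `(M, ℳ)` is sequentially Cohen--Macaulay with respect to `Q`. -/
def IsSequentiallyCM (ℳ : ℤ × ℤ → AddSubgroup M) : Prop :=
  ∃ (r : ℕ) (F : Fin (r + 1) → Submodule (S K m n) M), IsCMFiltration ℳ F

end Filtration

end BigradedCM

/-! The bottom factor of the filtration embeds in `M`, and some element of `Q` is regular on `M`, so
`H^0_Q` of that factor vanishes. By strict monotonicity every factor `C` then has its local
cohomology in a single degree `q + 1 ≥ 1`. Choose a linear form `y` in the `y_j` outside the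
associated primes of all factors and outside those minimal primes of the fiber ideals `J =
Ann(C/(x)C)` that do not contain `Q`; this is possible because `K` is infinite. Then `y` is regular
on every factor, hence on `M`, and `yM ∩ F i = y (F i)`, so the chain induced on `M/yM` has factors
`C/yC`. It remains to see that `C/yC` is concentrated in degree `q`: all degrees then drop by
exactly one and stay strictly increasing.

The long exact sequence leaves only the degrees `q` and `q + 1`. Degree `q` survives: otherwise `y`
would act injectively on `H^{q+1}_Q(C)`, where it is locally nilpotent. The heart is the vanishing
in degree `q + 1`. It rests on the equality of `cd(Q, C)` with `linearRank J`, the least number `d`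
of linear forms `z` generating `Q` up to radical modulo `J`, for nonzero finitely generated bigraded
`C`.

Upper bound (`IsSystem.localCohomologyVanishes`): a graded Nakayama argument shows that `Q` lies in
the radical of `Ann C + (z)`, and localization removes one `z_j` at a time. Lower bound
(`IsSystem.not_localCohomologyVanishes`): minimality of `d` makes `z` algebraically independent
modulo `J` (`IsLinearSystem.exists_lt`), so `C/(x)C` is a finite faithful module over `K[t_1, …,
t_d]` and has a nonzero functional; its iterated residues detect `H^d_Q(C)`. Finally,
`linearRank_lt` shows that the choice of `y` makes the rank drop. -/

namespace BigradedCM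

/-! ### Local cohomology as a filtered colimit of Ext modules -/

section LocalCohomology

open CategoryTheory Limits Opposite

variable {R : Type u} [CommRing R]

theorem comp_square_of_squares {C : Type*} [Category C] {A B D A' B' D' : C} {i : A ⟶ B} {j : B ⟶ D}
    {i' : A' ⟶ B'} {j' : B' ⟶ D'} {a : A ⟶ A'} {b : B ⟶ B'} {d : D ⟶ D'}
    (h : a ≫ i' = i ≫ b) (h' : b ≫ j' = j ≫ d) : a ≫ i' ≫ j' = (i ≫ j) ≫ d := by
  rw [← Category.assoc, h, Category.assoc, h', Category.assoc]

theorem square_inv {C : Type*} [Category C] {A B A' B' : C} {i : A ≅ B}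
    {i' : A' ≅ B'} {a : A ⟶ A'} {b : B ⟶ B'}
    (h : a ≫ i'.hom = i.hom ≫ b) : b ≫ i'.inv = i.inv ≫ a := by
  rw [Iso.eq_inv_comp, ← Category.assoc, ← h, Category.assoc, Iso.hom_inv_id, Category.comp_id]

theorem homologyUnop_naturality {ι V : Type*} [Category V] {c : ComplexShape ι} [HasZeroMorphisms V]
    {K L : HomologicalComplex Vᵒᵖ c} (φ : K ⟶ L) (i : ι) [K.HasHomology i] [L.HasHomology i] :
    (HomologicalComplex.homologyMap φ i).unop ≫ (K.homologyUnop i).inv =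
     (L.homologyUnop i).inv ≫
      HomologicalComplex.homologyMap ((HomologicalComplex.unopFunctor _ _).map φ.op) i :=

  square_inv (congrArg Quiver.Hom.unop
    (HomologicalComplex.homologyOp_hom_naturality
      ((HomologicalComplex.unopFunctor _ _).map φ.op) i)).symm

/-- The map of cochain complexes `Hom(P, Y) → Hom(P', Y)` induced by a map of resolutions. -/
noncomputable abbrev linearYonedaObjMap {X X' : ModuleCat.{u} R} {P : ProjectiveResolution X}
   {P' : ProjectiveResolution X'} {g : X' ⟶ X}
   (φ : ProjectiveResolution.Hom P' P g) (Y : ModuleCat.{u} R) :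
   P.complex.linearYonedaObj R Y ⟶ P'.complex.linearYonedaObj R Y :=
   ((HomologicalComplex.unopFunctor _ _).map
    ((((linearYoneda R _).obj Y).rightOp.mapHomologicalComplex _).map φ.hom).op)

/-- Allows the transition maps of the colimit defining local cohomology to be computed on cocycles,
through a lift of `g` to the resolutions. -/
theorem isoExt_naturality {X X' : ModuleCat.{u} R} (P : ProjectiveResolution X)
   (P' : ProjectiveResolution X')
   {g : X' ⟶ X} (φ : ProjectiveResolution.Hom P' P g) (n : ℕ) (Y : ModuleCat.{u} R) :
   ((Ext R (ModuleCat.{u} R) n).map g.op).app Y ≫ (P'.isoExt (R := R) n Y).hom =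
    (P.isoExt (R := R) n Y).hom ≫ HomologicalComplex.homologyMap (linearYonedaObjMap φ Y) n :=
  comp_square_of_squares (congrArg Quiver.Hom.unop
   (ProjectiveResolution.isoLeftDerivedObj_inv_naturality g P' P φ.hom
    (φ.hom_f_zero_comp_π_f_zero.trans (by simp)) ((linearYoneda R _).obj Y).rightOp n))
   (homologyUnop_naturality
    ((((linearYoneda R _).obj Y).rightOp.mapHomologicalComplex _).map φ.hom) n)

/-- The class `x` in the `n`-th homology of a cochain complex of modules is represented by the
cocycle `f`. -/
def IsRepresentedBy {K : CochainComplex (ModuleCat.{u} R) ℕ} {n : ℕ} (x : K.homology n)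
    (f : K.X n) : Prop :=
  ∃ c : K.cycles n, K.homologyπ n c = x ∧ K.iCycles n c = f

theorem exists_isRepresentedBy {K : CochainComplex (ModuleCat.{u} R) ℕ} {n : ℕ}
    (x : K.homology n) : ∃ f, K.d n (n + 1) f = 0 ∧ IsRepresentedBy x f := by
  obtain ⟨c, hc⟩ := (ModuleCat.epi_iff_surjective (K.homologyπ n)).1 inferInstance x
  refine ⟨K.iCycles n c, ?_, c, hc, rfl⟩
  rw [← ModuleCat.comp_apply]; simp

theorem exists_homology_isRepresentedBy {K : CochainComplex (ModuleCat.{u} R) ℕ} {n : ℕ}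
    (f : K.X n) (hf : K.d n (n + 1) f = 0) : ∃ x : K.homology n, IsRepresentedBy x f := by
  refine ⟨_, K.cyclesMk f (n + 1) (by simp) hf, rfl, ?_⟩
  exact K.i_cyclesMk f (n + 1) (by simp) hf

theorem IsRepresentedBy.eq_zero_iff {K : CochainComplex (ModuleCat.{u} R) ℕ} {n : ℕ}
    {x : K.homology n} {f : K.X n} (h : IsRepresentedBy x f) :
    x = 0 ↔ ∃ g, K.d ((ComplexShape.up ℕ).prev n) n g = f := by
  obtain ⟨c, rfl, rfl⟩ := h
  have hinj := (ModuleCat.mono_iff_injective (K.iCycles n)).1 inferInstance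
  constructor
  · intro h0
    have hex := ShortComplex.exact_of_g_is_cokernel
      (ShortComplex.mk _ _ (K.toCycles_comp_homologyπ ((ComplexShape.up ℕ).prev n) n))
      (K.homologyIsCokernel _ n rfl)
    obtain ⟨g, hg⟩ := (ShortComplex.moduleCat_exact_iff _).1 hex c h0
    refine ⟨g, ?_⟩
    rw [← hg, ← K.toCycles_i]; rfl
  · rintro ⟨g, hg⟩
    have : K.toCycles _ n g = c := by
      apply hinj
      rw [← hg, ← ModuleCat.comp_apply, K.toCycles_i]
    rw [← this, ← ModuleCat.comp_apply, K.toCycles_comp_homologyπ]; rfl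

theorem IsRepresentedBy.map {K L : CochainComplex (ModuleCat.{u} R) ℕ} {n : ℕ}
    {x : K.homology n} {f : K.X n} (h : IsRepresentedBy x f) (φ : K ⟶ L) :
    IsRepresentedBy (HomologicalComplex.homologyMap φ n x) (φ.f n f) := by
  obtain ⟨c, rfl, rfl⟩ := h
  refine ⟨HomologicalComplex.cyclesMap φ n c, ?_, ?_⟩
  · rw [← ModuleCat.comp_apply, ← HomologicalComplex.homologyπ_naturality]; rfl
  · rw [← ModuleCat.comp_apply, HomologicalComplex.cyclesMap_i]; rfl

theorem extMk_zero_eq_zero_iff {X Y : ModuleCat.{u} R} (P : ProjectiveResolution X)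
    (f : P.complex.X 0 ⟶ Y) (hf : P.complex.d 1 0 ≫ f = 0) :
    P.extMk f 1 rfl hf = 0 ↔ f = 0 := by
  refine ⟨fun h => ?_, fun h => by subst h; simp⟩
  rw [← P.extEquivCohomologyClass.apply_eq_iff_eq, P.extEquivCohomologyClass_extMk,
    P.extEquivCohomologyClass_zero, CochainComplex.HomComplex.CohomologyClass.mk_eq_zero_iff,
    CochainComplex.HomComplex.Cocycle.toSingleMk_mem_coboundaries_iff _ _ _ _ _ 1 (by simp)] at h
  obtain ⟨g, hg⟩ := h
  have hz : P.cochainComplex.d (-(0 : ℕ)) 1 = 0 := by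
    apply IsZero.eq_of_tgt
    exact P.complex.isZero_extend_X _ _ (by intro i hi; simp at hi; omega)
  rw [hz, zero_comp] at hg
  rw [← cancel_epi (P.cochainComplexXIso (-(0 : ℕ)) 0 rfl).hom, ← hg, comp_zero]

/-- The form with `prev` matches the coboundary criterion `IsRepresentedBy.eq_zero_iff` in every
degree; in degree `0` one has `prev 0 = 0` with zero differential. -/
theorem extMk_eq_zero_iff_prev {X Y : ModuleCat.{u} R} (P : ProjectiveResolution X) (n p : ℕ)
    (hp : (ComplexShape.up ℕ).prev n = p)
    (f : P.complex.X n ⟶ Y) (hf : P.complex.d (n + 1) n ≫ f = 0) :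
    P.extMk f (n + 1) rfl hf = 0 ↔
      ∃ g : P.complex.X p ⟶ Y, P.complex.d n p ≫ g = f := by
  cases n with
  | zero =>
    obtain rfl : 0 = p := CochainComplex.prev_nat_zero.symm.trans hp
    rw [extMk_zero_eq_zero_iff, P.complex.shape 0 0 (by simp)]
    simp [eq_comm]
  | succ n =>
    obtain rfl : n = p := (CochainComplex.prev_nat_succ n).symm.trans hp
    exact P.extMk_eq_zero_iff f _ rfl hf n rfl

/-- The projection `R ⧸ I ^ t' → R ⧸ I ^ t` for `t ≤ t'`. -/
abbrev powProj (I : Ideal R) {t t' : ℕ} (h : t ≤ t') :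
    ModuleCat.of R (R ⧸ I ^ t') ⟶ ModuleCat.of R (R ⧸ I ^ t) :=
  ModuleCat.ofHom (Submodule.mapQ _ _ LinearMap.id (Ideal.pow_le_pow_right h))

/-- Every class in `Ext^i(R ⧸ I ^ t, N)` is killed by the transition map to some
`Ext^i(R ⧸ I ^ t', N)`; this is the vanishing of `H^i_I(N)`. -/
def LocalCohomologyVanishes (I : Ideal R) (N : Type u) [AddCommGroup N] [Module R N]
    (i : ℕ) : Prop :=
  ∀ (t : ℕ) (e : Abelian.Ext (ModuleCat.of R (R ⧸ I ^ t)) (ModuleCat.of R N) i),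
    ∃ (t' : ℕ) (h : t ≤ t'), (Abelian.Ext.mk₀ (powProj I h)).comp e (zero_add i) = 0

/-- Every element comes from some stage, and it is zero exactly when a later stage kills it. -/
theorem subsingleton_colimit_iff {J : Type} [SmallCategory J] [IsFiltered J]
    (F : J ⥤ ModuleCat.{u} R) :
    Subsingleton (colimit F : ModuleCat.{u} R) ↔
      ∀ j (x : F.obj j), ∃ (k : J) (f : j ⟶ k), F.map f x = 0 := by
  have := preservesFilteredColimitsOfSize_shrink.{0, u, 0, u} (forget (ModuleCat.{u} R))
  constructor
  · intro h j x
    obtain ⟨k, f, g, hfg⟩ := (Concrete.colimit_rep_eq_iff_exists F x (0 : F.obj j)).1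
      (Subsingleton.elim (α := (colimit F : ModuleCat.{u} R)) _ _)
    exact ⟨k, f, hfg.trans (map_zero _)⟩
  · intro h
    refine subsingleton_of_forall_eq 0 fun y => ?_
    obtain ⟨j, x, rfl⟩ := Concrete.colimit_exists_rep F y
    obtain ⟨k, f, hf⟩ := h j x
    rw [← colimit.w F f, ModuleCat.comp_apply, hf, map_zero]

theorem subsingleton_H_iff_ext (I : Ideal R) (M : Type u) [AddCommGroup M] [Module R M] (i : ℕ) :
    Subsingleton (BigradedCM.H I M i) ↔
      ∀ (t : ℕ) (x : ((Ext R (ModuleCat.{u} R) i).obj (op (ModuleCat.of R (R ⧸ I ^ t)))).obj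
        (ModuleCat.of R M)), ∃ (t' : ℕ) (h : t ≤ t'),
        ((Ext R (ModuleCat.{u} R) i).map (powProj I h).op).app (ModuleCat.of R M) x = 0 := by
  have e := colimitObjIsoColimitCompEvaluation
    (localCohomology.diagram (localCohomology.idealPowersDiagram I) i) (ModuleCat.of R M)
  refine (e.toLinearEquiv.toEquiv.subsingleton_congr).trans ((subsingleton_colimit_iff _).trans ?_)
  constructor
  · intro H t x
    obtain ⟨k, f, hf⟩ := H (op (op t)) x
    exact ⟨k.unop.unop, f.unop.unop.down.down, hf⟩
  · intro H j x
    obtain ⟨t', h, hx⟩ := H j.unop.unop x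
    exact ⟨op (op t'), (homOfLE h).op.op, hx⟩

/-- A class in `Ext` computed by deriving `Hom` in the first variable is represented by the
cocycle `f`. -/
def IsRepresentedByHom {X Y : ModuleCat.{u} R} {n : ℕ} (P : ProjectiveResolution X)
    (x : ((Ext R (ModuleCat.{u} R) n).obj (op X)).obj Y) (f : P.complex.X n ⟶ Y) : Prop :=
  IsRepresentedBy ((P.isoExt n Y).hom x) f

theorem IsRepresentedByHom.eq_zero_iff {X Y : ModuleCat.{u} R} {n : ℕ}
    {P : ProjectiveResolution X} {x : ((Ext R (ModuleCat.{u} R) n).obj (op X)).obj Y}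
    {f : P.complex.X n ⟶ Y} (h : IsRepresentedByHom P x f) :
    x = 0 ↔ ∃ g : P.complex.X ((ComplexShape.up ℕ).prev n) ⟶ Y,
        P.complex.d n ((ComplexShape.up ℕ).prev n) ≫ g = f := by
  refine Iff.trans ?_ (IsRepresentedBy.eq_zero_iff h)
  exact ((P.isoExt (R := R) n Y).toLinearEquiv.map_eq_zero_iff (x := x)).symm

theorem IsRepresentedByHom.map {X X' Y : ModuleCat.{u} R} {n : ℕ}
    {P : ProjectiveResolution X} {P' : ProjectiveResolution X'}
    {x : ((Ext R (ModuleCat.{u} R) n).obj (op X)).obj Y}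
    {f : P.complex.X n ⟶ Y} (h : IsRepresentedByHom P x f) {g : X' ⟶ X}
    (φ : ProjectiveResolution.Hom P' P g) :
    IsRepresentedByHom P' (((Ext R (ModuleCat.{u} R) n).map g.op).app Y x) (φ.hom.f n ≫ f) := by
  have := IsRepresentedBy.map h (linearYonedaObjMap φ Y)
  have h2 := congrArg (fun (k : ((Ext R (ModuleCat.{u} R) n).obj (op X)).obj Y ⟶ _) => k x)
    (isoExt_naturality P P' φ n Y)
  unfold IsRepresentedByHom
  have h3 : (P'.isoExt n Y).hom (((Ext R (ModuleCat.{u} R) n).map g.op).app Y x) =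
    HomologicalComplex.homologyMap (linearYonedaObjMap φ Y) n ((P.isoExt (R := R) n Y).hom x) := h2
  rw [h3]
  exact this

/-- Classes of either version of Ext are represented by the same cocycles on a projective resolution
of `R ⧸ I ^ t`, with the same coboundaries. The long exact sequences of `Abelian.Ext` thus become
available. -/
theorem subsingleton_H_iff (I : Ideal R) (M : Type u) [AddCommGroup M] [Module R M] (i : ℕ) :
    Subsingleton (BigradedCM.H I M i) ↔ LocalCohomologyVanishes I M i := by
  let P (t : ℕ) : ProjectiveResolution (ModuleCat.of R (R ⧸ I ^ t)) := projectiveResolution _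
  rw [subsingleton_H_iff_ext]
  have key : ∀ (t : ℕ) (x : ((Ext R (ModuleCat.{u} R) i).obj (op (ModuleCat.of R (R ⧸ I ^ t)))).obj
        (ModuleCat.of R M)) f (hf : (P t).complex.d (i + 1) i ≫ f = 0)
      (_ : IsRepresentedByHom (P t) x f)
      (t' : ℕ) (h : t ≤ t'),
      ((Ext R (ModuleCat.{u} R) i).map (powProj I h).op).app (ModuleCat.of R M) x = 0 ↔
      (Abelian.Ext.mk₀ (powProj I h)).comp
       ((P t).extMk f (i + 1) rfl hf) (zero_add i) = 0 := by
    intro t x f hf hx t' h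
    let φ : ProjectiveResolution.Hom (P t')
      (P t) (powProj I h) :=
      ⟨ProjectiveResolution.lift _ _ _, (ProjectiveResolution.lift_commutes_zero _ _ _).trans rfl⟩
    rw [(hx.map φ).eq_zero_iff, ProjectiveResolution.mk₀_comp_extMk f _ rfl hf φ,
      extMk_eq_zero_iff_prev _ _ _ rfl]
  constructor
  · intro H t e
    obtain ⟨f, hf, rfl⟩ := (P t).extMk_surjective e (i + 1) rfl
    obtain ⟨y, hy⟩ := exists_homology_isRepresentedBy
      (K := (P t).complex.linearYonedaObj R (ModuleCat.of R M)) f hf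
    have hx : IsRepresentedByHom (P t)
      ((ProjectiveResolution.isoExt _ _ _).inv y) f := by
      unfold IsRepresentedByHom
      have : (ProjectiveResolution.isoExt _ _ _).hom
          ((ProjectiveResolution.isoExt (R := R) (P t) i (ModuleCat.of R M)).inv y) = y := by
        rw [← ModuleCat.comp_apply, Iso.inv_hom_id]; rfl
      rw [this]
      exact hy
    obtain ⟨t', h, h0⟩ := H t _
    exact ⟨t', h, (key t _ f hf hx t' h).1 h0⟩
  · intro H t x
    obtain ⟨f, hf, hx⟩ := exists_isRepresentedBy
      ((ProjectiveResolution.isoExt (P t) i (ModuleCat.of R M)).hom x)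
    obtain ⟨t', h, h0⟩ := H t (ProjectiveResolution.extMk _ f (i + 1) rfl hf)
    exact ⟨t', h, (key t x f hf hx t' h).2 h0⟩

/-- The short exact sequence of modules given by an injection `f` and a surjection `g`. -/
abbrev sesOf {A B C : Type u} [AddCommGroup A] [Module R A] [AddCommGroup B] [Module R B]
    [AddCommGroup C] [Module R C] (f : A →ₗ[R] B) (g : B →ₗ[R] C) (h : Function.Exact f g) :
    ShortComplex (ModuleCat.{u} R) :=
  ShortComplex.mk (ModuleCat.ofHom f) (ModuleCat.ofHom g) (by
    ext; exact h.apply_apply_eq_zero _)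

/-! ### Vanishing along short exact sequences -/

section LongExactSequence

variable {A B C : Type u} [AddCommGroup A] [Module R A] [AddCommGroup B] [Module R B]
    [AddCommGroup C] [Module R C] {f : A →ₗ[R] B} {g : B →ₗ[R] C}

theorem sesOf_shortExact (hf : Function.Injective f) (hg : Function.Surjective g)
    (h : Function.Exact f g) : (sesOf f g h).ShortExact :=
  ModuleCat.shortComplex_shortExact _ h hf hg

variable {I : Ideal R} {i : ℕ}

theorem powProj_comp {t t' t'' : ℕ} (h : t ≤ t') (h' : t' ≤ t'') :
    powProj I h' ≫ powProj I h = powProj I (h.trans h') := by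
  ext; rfl

theorem mk₀_powProj_comp {N : ModuleCat.{u} R} {t t' t'' : ℕ} (h : t ≤ t') (h' : t' ≤ t'')
    (e : Abelian.Ext (ModuleCat.of R (R ⧸ I ^ t)) N i) :
    (Abelian.Ext.mk₀ (powProj I h')).comp ((Abelian.Ext.mk₀ (powProj I h)).comp e (zero_add i))
      (zero_add i) = (Abelian.Ext.mk₀ (powProj I (h.trans h'))).comp e (zero_add i) := by
  rw [Abelian.Ext.mk₀_comp_mk₀_assoc, powProj_comp]

/-- A chase on one class: a first increase of the exponent kills its image, so it lifts; a second
increase kills the lift. The other two positions follow the same pattern. -/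
theorem LocalCohomologyVanishes.middle (hf : Function.Injective f) (hg : Function.Surjective g)
    (h : Function.Exact f g) (hA : LocalCohomologyVanishes I A i)
    (hC : LocalCohomologyVanishes I C i) : LocalCohomologyVanishes I B i := by
  intro t e
  obtain ⟨t₁, h₁, e₁⟩ := hC t (e.comp (Abelian.Ext.mk₀ (sesOf f g h).g) (add_zero i))
  rw [← Abelian.Ext.comp_assoc_of_third_deg_zero] at e₁
  obtain ⟨a, ha⟩ := Abelian.Ext.covariant_sequence_exact₂ _ (sesOf_shortExact hf hg h) _ e₁
  obtain ⟨t₂, h₂, e₂⟩ := hA t₁ a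
  refine ⟨t₂, h₁.trans h₂, ?_⟩
  rw [← mk₀_powProj_comp h₁ h₂, ← ha, ← Abelian.Ext.comp_assoc_of_third_deg_zero, e₂,
    Abelian.Ext.zero_comp]

theorem LocalCohomologyVanishes.right (hf : Function.Injective f) (hg : Function.Surjective g)
    (h : Function.Exact f g) (hB : LocalCohomologyVanishes I B i)
    (hA : LocalCohomologyVanishes I A (i + 1)) : LocalCohomologyVanishes I C i := by
  intro t e
  obtain ⟨t₁, h₁, e₁⟩ := hA t (e.comp (sesOf_shortExact hf hg h).extClass rfl)
  rw [← Abelian.Ext.comp_assoc _ _ _ (zero_add i) rfl (by omega)] at e₁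
  obtain ⟨b, hb⟩ := Abelian.Ext.covariant_sequence_exact₃ _ (sesOf_shortExact hf hg h) _ rfl e₁
  obtain ⟨t₂, h₂, e₂⟩ := hB t₁ b
  refine ⟨t₂, h₁.trans h₂, ?_⟩
  rw [← mk₀_powProj_comp h₁ h₂, ← hb, ← Abelian.Ext.comp_assoc_of_third_deg_zero, e₂,
    Abelian.Ext.zero_comp]

/-- If the restriction of `a` to a larger power dies in the middle term and `H^i` of the right
term vanishes, then `a` dies. -/
theorem exists_powProj_comp_eq_zero (hf : Function.Injective f) (hg : Function.Surjective g)
    (h : Function.Exact f g) (hC : LocalCohomologyVanishes I C i) {t : ℕ}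
    (a : Abelian.Ext (ModuleCat.of R (R ⧸ I ^ t)) (ModuleCat.of R A) (i + 1))
    (ha : a.comp (Abelian.Ext.mk₀ (sesOf f g h).f) (add_zero _) = 0) :
    ∃ (t' : ℕ) (h : t ≤ t'), (Abelian.Ext.mk₀ (powProj I h)).comp a (zero_add _) = 0 := by
  obtain ⟨c, hc⟩ := Abelian.Ext.covariant_sequence_exact₁ _ (sesOf_shortExact hf hg h) a ha rfl
  obtain ⟨t₂, h₂, e₂⟩ := hC t c
  refine ⟨t₂, h₂, ?_⟩
  rw [← hc, ← Abelian.Ext.comp_assoc _ _ _ (zero_add i) rfl (by omega), e₂,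
    Abelian.Ext.zero_comp]

theorem LocalCohomologyVanishes.left (hf : Function.Injective f) (hg : Function.Surjective g)
    (h : Function.Exact f g) (hC : LocalCohomologyVanishes I C i)
    (hB : LocalCohomologyVanishes I B (i + 1)) : LocalCohomologyVanishes I A (i + 1) := by
  intro t e
  obtain ⟨t₁, h₁, e₁⟩ := hB t (e.comp (Abelian.Ext.mk₀ (sesOf f g h).f) (add_zero _))
  rw [← Abelian.Ext.comp_assoc_of_third_deg_zero] at e₁
  obtain ⟨t₂, h₂, e₂⟩ := exists_powProj_comp_eq_zero hf hg h hC _ e₁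
  exact ⟨t₂, h₁.trans h₂, by rw [← mk₀_powProj_comp h₁ h₂, e₂]⟩

end LongExactSequence

/-! ### The action of elements of the ideal, and degree zero -/

section Multiplication

variable {I : Ideal R} {i : ℕ} {N : Type u} [AddCommGroup N] [Module R N]

/-- Scalars may be moved to the first argument, where `r` acts as zero. -/
theorem smul_ext_quotient_eq_zero {t : ℕ} {r : R} (hr : r ∈ I ^ t) {N : ModuleCat.{u} R}
    (e : Abelian.Ext (ModuleCat.of R (R ⧸ I ^ t)) N i) : r • e = 0 := by
  have h0 : (r • 𝟙 (ModuleCat.of R (R ⧸ I ^ t))) = 0 := by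
    refine ModuleCat.hom_ext (LinearMap.ext fun x => ?_)
    obtain ⟨x, rfl⟩ := Ideal.Quotient.mk_surjective x
    change r • (Ideal.Quotient.mk (I ^ t) x) = 0
    rw [Algebra.smul_def, Ideal.Quotient.algebraMap_eq, ← map_mul, Ideal.Quotient.eq_zero_iff_mem]
    exact Ideal.mul_mem_right _ _ hr
  have : r • e = (Abelian.Ext.mk₀ (r • 𝟙 (ModuleCat.of R (R ⧸ I ^ t)))).comp e (zero_add i) := by
    rw [Abelian.Ext.mk₀_smul, Abelian.Ext.smul_comp, Abelian.Ext.mk₀_id_comp]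
  rw [this, h0, Abelian.Ext.mk₀_zero, Abelian.Ext.zero_comp]

/-- If `y ∈ I` acts injectively on `N` and `H^i(N/yN) = 0` then `H^{i+1}(N) = 0`. -/
theorem LocalCohomologyVanishes.of_quotient {C : Type u} [AddCommGroup C] [Module R C]
    {y : R} (hy : y ∈ I) {g : N →ₗ[R] C} (hf : Function.Injective (LinearMap.lsmul R N y))
    (hg : Function.Surjective g) (h : Function.Exact (LinearMap.lsmul R N y) g)
    (hC : LocalCohomologyVanishes I C i) : LocalCohomologyVanishes I N (i + 1) := by
  -- Since `H^i(N/yN) = 0`, multiplication by `y` is injective in the colimit; the factors of `y ^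
  -- k` are peeled off one at a time, each at the cost of a larger exponent.
  have key : ∀ (k t : ℕ) (e : Abelian.Ext (ModuleCat.of R (R ⧸ I ^ t)) (ModuleCat.of R N) (i + 1)),
      y ^ k • e = 0 → ∃ (t' : ℕ) (h : t ≤ t'),
      (Abelian.Ext.mk₀ (powProj I h)).comp e (zero_add _) = 0 := by
    intro k
    induction k with
    | zero => intro t e he; exact ⟨t, le_rfl, by simp at he; simp [he]⟩
    | succ k ih =>
      intro t e he
      obtain ⟨t₁, h₁, e₁⟩ := exists_powProj_comp_eq_zero hf hg h hC (y ^ k • e) (by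
        refine Eq.trans ?_ he
        rw [pow_succ', mul_smul, Abelian.Ext.smul_eq_comp_mk₀ _ y]
        congr 2)
      rw [Abelian.Ext.comp_smul] at e₁
      obtain ⟨t₂, h₂, e₂⟩ := ih t₁ _ e₁
      exact ⟨t₂, h₁.trans h₂, by rw [← mk₀_powProj_comp h₁ h₂, e₂]⟩
  intro t e
  exact key t t e (smul_ext_quotient_eq_zero (Ideal.pow_mem_pow hy t) e)

/-- On each Ext module `y` is invertible through `N` and nilpotent through `R ⧸ I ^ t`, so already
the finite stages are zero. -/
theorem localCohomologyVanishes_of_bijective {y : R} (hy : y ∈ I)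
    (hb : Function.Bijective (LinearMap.lsmul R N y)) : LocalCohomologyVanishes I N i := by
  intro t e
  refine ⟨t, le_rfl, ?_⟩
  suffices e = 0 by rw [this, Abelian.Ext.comp_zero]
  have : IsIso (y • 𝟙 (ModuleCat.of R N)) := by
    have : y • 𝟙 (ModuleCat.of R N) = (LinearEquiv.ofBijective _ hb).toModuleIso.hom := by
      ext x; rfl
    rw [this]; infer_instance
  have hinj : ∀ e : Abelian.Ext (ModuleCat.of R (R ⧸ I ^ t)) (ModuleCat.of R N) i,
      y • e = 0 → e = 0 := by
    intro e he
    rw [Abelian.Ext.smul_eq_comp_mk₀] at he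
    have := congrArg (fun z => z.comp (Abelian.Ext.mk₀ (inv (y • 𝟙 (ModuleCat.of R N))))
      (add_zero i)) he
    rw [Abelian.Ext.comp_assoc_of_third_deg_zero, Abelian.Ext.mk₀_comp_mk₀, IsIso.hom_inv_id,
      Abelian.Ext.comp_mk₀_id, Abelian.Ext.zero_comp] at this
    exact this
  have hpow : ∀ k : ℕ, y ^ k • e = 0 → e = 0 := by
    intro k
    induction k with
    | zero => intro h; simpa using h
    | succ k ih => intro h; rw [pow_succ', mul_smul] at h; exact ih (hinj _ h)
  exact hpow t (smul_ext_quotient_eq_zero (Ideal.pow_mem_pow hy t) e)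

theorem localCohomologyVanishes_succ_of_injective [Injective (ModuleCat.of R N)] :
    LocalCohomologyVanishes I N (i + 1) := fun t e =>
  ⟨t, le_rfl, by rw [Abelian.Ext.eq_zero_of_injective e, Abelian.Ext.comp_zero]⟩

/-- The linear map `R ⧸ I ^ t → N` determined by an element killed by `I ^ t`. -/
abbrev quotientPowHom {t : ℕ} (n : N) (hn : ∀ r ∈ I ^ t, r • n = 0) : (R ⧸ I ^ t) →ₗ[R] N :=
  Submodule.liftQ (I ^ t) (LinearMap.toSpanSingleton R N n) (fun r hr => hn r hr)

theorem localCohomologyVanishes_zero_iff :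
    LocalCohomologyVanishes I N 0 ↔ ∀ (n : N) (t : ℕ), (∀ r ∈ I ^ t, r • n = 0) → n = 0 := by
  constructor
  · intro h n t hn
    obtain ⟨t', ht, h0⟩ := h t (Abelian.Ext.mk₀ (ModuleCat.ofHom (quotientPowHom n hn)))
    rw [Abelian.Ext.mk₀_comp_mk₀, Abelian.Ext.mk₀_eq_zero_iff] at h0
    have := congrArg (fun z => z.hom (Ideal.Quotient.mk (I ^ t') 1)) h0
    have h1 : (1 : R) • n = 0 := this
    simpa using h1
  · intro h t e
    obtain ⟨g, rfl⟩ := Abelian.Ext.homEquiv₀.symm.surjective e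
    refine ⟨t, le_rfl, ?_⟩
    suffices g = 0 by subst this; simp
    refine ModuleCat.hom_ext (LinearMap.ext fun x => h _ t fun r hr => ?_)
    rw [← map_smul]
    obtain ⟨x, rfl⟩ := Ideal.Quotient.mk_surjective x
    have : r • (Ideal.Quotient.mk (I ^ t) x) = 0 := by
      rw [Algebra.smul_def, Ideal.Quotient.algebraMap_eq, ← map_mul,
        Ideal.Quotient.eq_zero_iff_mem]
      exact Ideal.mul_mem_right _ _ hr
    exact (congrArg _ this).trans (map_zero _)

end Multiplication

/-! ### Torsion modules have no higher local cohomology -/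

section Torsion

variable (I : Ideal R) (N : Type u) [AddCommGroup N] [Module R N]

/-- The submodule of elements killed by a power of `I`. -/
def powTorsion : Submodule R N where
  carrier := {n | ∃ k : ℕ, ∀ r ∈ I ^ k, r • n = 0}
  zero_mem' := ⟨0, fun r _ => smul_zero r⟩
  add_mem' := by
    rintro a b ⟨k, hk⟩ ⟨l, hl⟩
    refine ⟨k + l, fun r hr => ?_⟩
    rw [smul_add, hk r (Ideal.pow_le_pow_right (by omega) hr),
      hl r (Ideal.pow_le_pow_right (by omega) hr), add_zero]
  smul_mem' := by
    rintro c a ⟨k, hk⟩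
    exact ⟨k, fun r hr => by rw [smul_comm, hk r hr, smul_zero]⟩

variable {I N}

theorem exists_forall_pow_smul_eq_zero [IsNoetherianRing R] {J : Ideal R}
    (g : J →ₗ[R] powTorsion I N) : ∃ k : ℕ, ∀ (x : J), ∀ r ∈ I ^ k, r • g x = 0 := by
  let T : ℕ →o Submodule R J :=
    { toFun := fun k =>
        { carrier := {x | ∀ r ∈ I ^ k, r • g x = 0}
          zero_mem' := fun r _ => by simp
          add_mem' := fun {a b} ha hb r hr => by rw [map_add, smul_add, ha r hr, hb r hr, add_zero]
          smul_mem' := fun c a ha r hr => by rw [map_smul, smul_comm, ha r hr, smul_zero] }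
      monotone' := fun k l hkl x hx r hr => hx r (Ideal.pow_le_pow_right hkl hr) }
  obtain ⟨k, hk⟩ := monotone_stabilizes_iff_noetherian.2 (inferInstance : IsNoetherian R J) T
  refine ⟨k, fun x => ?_⟩
  obtain ⟨l, hl⟩ := (g x).2
  have hx : x ∈ T (max k l) := fun r hr =>
    Subtype.ext (hl r (Ideal.pow_le_pow_right (le_max_right k l) hr))
  rw [← hk _ (le_max_left k l)] at hx
  exact hx

theorem exists_pow_inf_le_pow_smul [IsNoetherianRing R] (I J : Ideal R) (k : ℕ) :
    ∃ m, I ^ m ⊓ J ≤ I ^ k • J := by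
  obtain ⟨c, hc⟩ := Ideal.exists_pow_inf_eq_pow_smul I (J : Submodule R R)
  refine ⟨c + k, ?_⟩
  have := hc (c + k) (by omega)
  rw [Nat.add_sub_cancel_left, smul_eq_mul, Ideal.mul_top] at this
  rw [this]
  exact Submodule.smul_mono le_rfl inf_le_right

/-- Baer's criterion. A map `g` on `J` is killed by one power `I ^ k`, so by Artin–Rees it vanishes
on `I ^ m ⊓ J` for some `m`. It then factors through a submodule of `R ⧸ I ^ m`, and any extension
of this to `R ⧸ I ^ m` with values in `N` lands in the torsion. -/
theorem injective_powTorsion [IsNoetherianRing R] [Module.Injective R N] :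
    Module.Injective R (powTorsion I N) := by
  apply Module.Baer.injective
  intro J g
  obtain ⟨k, hk⟩ := exists_forall_pow_smul_eq_zero g
  obtain ⟨m, hm⟩ := exists_pow_inf_le_pow_smul I J k
  have hzero : ∀ x : J, (x : R) ∈ I ^ m → g x = 0 := by
    intro x hx
    have : ∃ h : (x : R) ∈ J, g ⟨x, h⟩ = 0 := by
      refine Submodule.smul_induction_on (p := fun x => ∃ h : x ∈ J, g ⟨x, h⟩ = 0)
        (hm ⟨hx, x.2⟩) ?_ ?_
      · intro r hr n hn
        refine ⟨J.mul_mem_left r hn, ?_⟩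
        exact (g.map_smul r ⟨n, hn⟩).trans (hk _ r hr)
      · rintro x y ⟨hx, hgx⟩ ⟨hy, hgy⟩
        refine ⟨add_mem hx hy, ?_⟩
        exact (g.map_add ⟨x, hx⟩ ⟨y, hy⟩).trans (by rw [hgx, hgy, add_zero])
    exact this.2
  let J' : Submodule R J := Submodule.comap J.subtype (I ^ m)
  let f : (J ⧸ J') →ₗ[R] (R ⧸ I ^ m) := Submodule.mapQ J' (I ^ m) J.subtype le_rfl
  have hf : Function.Injective f := by
    rw [← LinearMap.ker_eq_bot, Submodule.ker_mapQ]
    exact J'.mkQ_map_self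
  let g₀ : (J ⧸ J') →ₗ[R] N :=
    Submodule.liftQ J' ((powTorsion I N).subtype ∘ₗ g) fun x hx => by
      rw [LinearMap.mem_ker, LinearMap.comp_apply, hzero x hx, map_zero]
  obtain ⟨h, hh⟩ := Module.Injective.out f hf g₀
  refine ⟨(h ∘ₗ (I ^ m).mkQ).codRestrict _ fun r => ⟨m, fun s hs => ?_⟩, fun x hx => ?_⟩
  · rw [← map_smul, LinearMap.comp_apply, Submodule.mkQ_apply,
      (Submodule.Quotient.mk_eq_zero (I ^ m)).2
        (show s • r ∈ I ^ m from (I ^ m).mul_mem_right r hs),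
      map_zero]
  · apply Subtype.ext
    exact hh (Submodule.Quotient.mk ⟨x, hx⟩)

theorem exists_injective_torsion_embedding [IsNoetherianRing R] (hN : powTorsion I N = ⊤) :
    ∃ (E : Type u) (_ : AddCommGroup E) (_ : Module R E) (f : N →ₗ[R] E),
      Function.Injective f ∧ powTorsion I E = ⊤ ∧ Module.Injective R E := by
  let E₀ := Injective.under (ModuleCat.of R N)
  have : Injective E₀ := Injective.injective_under _
  have : Module.Injective R E₀ :=
    (Module.injective_iff_injective_object R E₀).2 this
  let f₀ : N →ₗ[R] E₀ := (Injective.ι (ModuleCat.of R N)).hom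
  have hf₀ : Function.Injective f₀ := (ModuleCat.mono_iff_injective _).1 inferInstance
  refine ⟨powTorsion I E₀, inferInstance, inferInstance, f₀.codRestrict _ fun n => ?_, ?_, ?_,
    injective_powTorsion⟩
  · obtain ⟨k, hk⟩ : n ∈ powTorsion I N := hN ▸ trivial
    exact ⟨k, fun r hr => by rw [← map_smul, hk r hr, map_zero]⟩
  · intro a b hab
    exact hf₀ (congrArg Subtype.val hab)
  · rw [eq_top_iff]
    rintro ⟨x, k, hk⟩ -
    exact ⟨k, fun r hr => Subtype.ext (hk r hr)⟩

theorem powTorsion_eq_top_of_surjective {N' : Type u} [AddCommGroup N'] [Module R N']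
    {g : N →ₗ[R] N'} (hg : Function.Surjective g) (h : powTorsion I N = ⊤) :
    powTorsion I N' = ⊤ := by
  rw [eq_top_iff]
  intro x _
  obtain ⟨n, rfl⟩ := hg x
  obtain ⟨k, hk⟩ : n ∈ powTorsion I N := h ▸ trivial
  exact ⟨k, fun r hr => by rw [← map_smul, hk r hr, map_zero]⟩

/-- A degree one class is the coboundary of some `c : R ⧸ I ^ t → C`. A preimage in `B` of `c 1` is
killed by some `I ^ k`, so `c` lifts to `B` once `t` is replaced by `max t k`, and its coboundary
dies. -/
theorem localCohomologyVanishes_one_of_surjection {A B C : Type u} [AddCommGroup A] [Module R A]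
    [AddCommGroup B] [Module R B] [AddCommGroup C] [Module R C] {f : A →ₗ[R] B} {g : B →ₗ[R] C}
    (hf : Function.Injective f) (hg : Function.Surjective g) (h : Function.Exact f g)
    (hB : powTorsion I B = ⊤) [Injective (ModuleCat.of R B)] :
    LocalCohomologyVanishes I A 1 := by
  intro t e
  obtain ⟨c, hc⟩ := Abelian.Ext.covariant_sequence_exact₁ _ (sesOf_shortExact hf hg h) e
    (Abelian.Ext.eq_zero_of_injective _) (zero_add 1)
  obtain ⟨c, rfl⟩ := Abelian.Ext.homEquiv₀.symm.surjective c
  obtain ⟨b, hb⟩ := hg (c.hom (Ideal.Quotient.mk (I ^ t) 1))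
  obtain ⟨k, hk⟩ : b ∈ powTorsion I B := hB ▸ trivial
  have ht : t ≤ max t k := le_max_left _ _
  let b' : ModuleCat.of R (R ⧸ I ^ (max t k)) ⟶ ModuleCat.of R B :=
    ModuleCat.ofHom (quotientPowHom b fun r hr =>
      hk r (Ideal.pow_le_pow_right (le_max_right t k) hr))
  have hcomp : powProj I ht ≫ c = b' ≫ (sesOf f g h).g := by
    refine ModuleCat.hom_ext (LinearMap.ext fun x => ?_)
    obtain ⟨x, rfl⟩ := Ideal.Quotient.mk_surjective x
    change c.hom (Ideal.Quotient.mk (I ^ t) x) = g (x • b)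
    rw [map_smul, hb, ← map_smul, Algebra.smul_def, Ideal.Quotient.algebraMap_eq, ← map_mul,
      mul_one]
  refine ⟨_, ht, ?_⟩
  rw [← hc]
  change (Abelian.Ext.mk₀ _).comp ((Abelian.Ext.mk₀ c).comp _ _) _ = 0
  rw [Abelian.Ext.mk₀_comp_mk₀_assoc, hcomp, ← Abelian.Ext.mk₀_comp_mk₀_assoc,
    (sesOf_shortExact hf hg h).comp_extClass, Abelian.Ext.comp_zero]

/-- Dimension shifting: `N` embeds in a torsion injective module, whose quotient by `N` is again
torsion. -/
theorem localCohomologyVanishes_succ_of_torsion [IsNoetherianRing R] (hN : powTorsion I N = ⊤)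
    (i : ℕ) : LocalCohomologyVanishes I N (i + 1) := by
  induction i generalizing N with
  | zero =>
    obtain ⟨E, _, _, f, hf, hE, hinj⟩ := exists_injective_torsion_embedding hN
    have : Injective (ModuleCat.of R E) := Module.injective_object_of_injective_module R E
    exact localCohomologyVanishes_one_of_surjection hf (LinearMap.range f).mkQ_surjective
      (LinearMap.exact_map_mkQ_range f) hE
  | succ i ih =>
    obtain ⟨E, _, _, f, hf, hE, hinj⟩ := exists_injective_torsion_embedding hN
    have : Injective (ModuleCat.of R E) := Module.injective_object_of_injective_module R E
    exact LocalCohomologyVanishes.left hf (LinearMap.range f).mkQ_surjective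
      (LinearMap.exact_map_mkQ_range f)
      (ih (powTorsion_eq_top_of_surjective (LinearMap.range f).mkQ_surjective hE))
      localCohomologyVanishes_succ_of_injective

end Torsion

/-! ### The kernel and cokernel of `N → N_z` -/

section Localization

variable (z : R) (N : Type u) [AddCommGroup N] [Module R N]

/-- The localization `N_z`. -/
abbrev LocAway : Type u := LocalizedModule (Submonoid.powers z) N

/-- The canonical map `N → N_z`. -/
noncomputable abbrev locMap : N →ₗ[R] LocAway z N := LocalizedModule.mkLinearMap _ N

/-- The cokernel of `N → N_z`, the first local cohomology of `N` with respect to `z`. -/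
abbrev LocCoker : Type u := LocAway z N ⧸ LinearMap.range (locMap z N)

variable {z N}

theorem lsmul_locAway_bijective : Function.Bijective (LinearMap.lsmul R (LocAway z N) z) :=
  (Module.End.isUnit_iff _).1
    (IsLocalizedModule.map_units (locMap z N) ⟨z, Submonoid.mem_powers z⟩)

theorem exists_pow_smul_eq_locMap (x : LocAway z N) :
    ∃ (n : N) (t : ℕ), z ^ t • x = locMap z N n := by
  obtain ⟨⟨n, ⟨_, t, rfl⟩⟩, h⟩ := IsLocalizedModule.surj (Submonoid.powers z) (locMap z N) x
  exact ⟨n, t, h⟩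

theorem locMap_eq_iff {n n' : N} : locMap z N n = locMap z N n' ↔ ∃ k, z ^ k • n = z ^ k • n' := by
  rw [IsLocalizedModule.eq_iff_exists (Submonoid.powers z)]
  constructor
  · rintro ⟨⟨_, k, rfl⟩, h⟩; exact ⟨k, h⟩
  · rintro ⟨k, h⟩; exact ⟨⟨_, k, rfl⟩, h⟩

theorem pow_smul_locAway_injective (t : ℕ) {x y : LocAway z N} (h : z ^ t • x = z ^ t • y) :
    x = y := by
  induction t with
  | zero => simpa using h
  | succ t ih =>
    rw [pow_succ', mul_smul, mul_smul] at h
    exact ih (lsmul_locAway_bijective.1 h)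

theorem exists_pow_smul_eq_zero_of_mem_ker {n : N} (hn : n ∈ LinearMap.ker (locMap z N)) :
    ∃ k, z ^ k • n = 0 := by
  have : locMap z N n = locMap z N 0 := by rw [map_zero]; exact hn
  obtain ⟨k, hk⟩ := locMap_eq_iff.1 this
  exact ⟨k, by rw [hk, smul_zero]⟩

/-- A fraction `n / z ^ k` is killed by whatever kills `n`, and `z ^ k` clears its denominator. -/
theorem exists_torsionOf_le_locCoker (x : LocCoker z N) :
    ∃ (n : N) (k : ℕ), Ideal.torsionOf R N n ≤ Ideal.torsionOf R _ x ∧ z ^ k • x = 0 := by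
  obtain ⟨x, rfl⟩ := Submodule.Quotient.mk_surjective _ x
  obtain ⟨n, t, h⟩ := exists_pow_smul_eq_locMap x
  refine ⟨n, t, fun r hr => ?_, ?_⟩
  · rw [Ideal.mem_torsionOf_iff] at hr ⊢
    have : r • x = 0 := by
      apply pow_smul_locAway_injective t
      rw [smul_comm, h, ← map_smul, hr, map_zero, smul_zero]
    rw [← Submodule.Quotient.mk_smul, this, Submodule.Quotient.mk_zero]
  · rw [← Submodule.Quotient.mk_smul, h, Submodule.Quotient.mk_eq_zero]
    exact LinearMap.mem_range_self _ _

variable {I : Ideal R} {i : ℕ}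

/-- The map `N → N_z` splits into two short exact sequences through its range, and `N_z` has no
local cohomology because `z ∈ I` is invertible on it. -/
theorem LocalCohomologyVanishes.of_localization (hz : z ∈ I)
    (hK : LocalCohomologyVanishes I (LinearMap.ker (locMap z N)) (i + 1))
    (hT : LocalCohomologyVanishes I (LocCoker z N) i) : LocalCohomologyVanishes I N (i + 1) := by
  have hrange : LocalCohomologyVanishes I (LinearMap.range (locMap z N)) (i + 1) :=
    LocalCohomologyVanishes.left (LinearMap.range (locMap z N)).injective_subtype
      (Submodule.mkQ_surjective _) (LinearMap.exact_subtype_mkQ _) hT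
      (localCohomologyVanishes_of_bijective hz lsmul_locAway_bijective)
  exact LocalCohomologyVanishes.middle (LinearMap.ker (locMap z N)).injective_subtype
    (locMap z N).surjective_rangeRestrict
    (by rw [LinearMap.exact_iff, LinearMap.ker_rangeRestrict, Submodule.range_subtype]) hK hrange

theorem LocalCohomologyVanishes.locCoker (hz : z ∈ I)
    (hK : LocalCohomologyVanishes I (LinearMap.ker (locMap z N)) (i + 2))
    (hN : LocalCohomologyVanishes I N (i + 1)) : LocalCohomologyVanishes I (LocCoker z N) i := by
  have hrange : LocalCohomologyVanishes I (LinearMap.range (locMap z N)) (i + 1) :=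
    LocalCohomologyVanishes.right (LinearMap.ker (locMap z N)).injective_subtype
      (locMap z N).surjective_rangeRestrict
      (by rw [LinearMap.exact_iff, LinearMap.ker_rangeRestrict, Submodule.range_subtype]) hN hK
  exact LocalCohomologyVanishes.right (LinearMap.range (locMap z N)).injective_subtype
      (Submodule.mkQ_surjective _) (LinearMap.exact_subtype_mkQ _)
      (localCohomologyVanishes_of_bijective hz lsmul_locAway_bijective) hrange

end Localization

/-! ### Bounding and detecting the top local cohomology by a system of elements -/

section Systems

/-- Locally on `N`, the ideal `I` is contained in the radical of the annihilator and of the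
ideal generated by the sequence `z`. -/
def IsSystem (I : Ideal R) {d : ℕ} (z : Fin d → R) (N : Type u) [AddCommGroup N] [Module R N] :
    Prop :=
  ∀ n : N, I ≤ (Ideal.torsionOf R N n ⊔ Ideal.span (Set.range z)).radical

variable {I : Ideal R} {N : Type u} [AddCommGroup N] [Module R N]

/-- On `N'` some power of `z 0` annihilates each element, so `z 0` is redundant up to radical. -/
theorem IsSystem.tail {d : ℕ} {z : Fin (d + 1) → R} (h : IsSystem I z N)
    {N' : Type u} [AddCommGroup N'] [Module R N']
    (h' : ∀ x : N', ∃ (n : N) (k : ℕ), Ideal.torsionOf R N n ≤ Ideal.torsionOf R N' x ∧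
      z 0 ^ k • x = 0) : IsSystem I (Fin.tail z) N' := by
  intro x
  obtain ⟨n, k, hn, hk⟩ := h' x
  rw [← Ideal.radical_idem (Ideal.torsionOf R N' x ⊔ _)]
  refine (h n).trans (Ideal.radical_mono (sup_le ?_ ?_))
  · exact hn.trans (le_sup_left.trans Ideal.le_radical)
  · rw [Ideal.span_le]
    rintro _ ⟨j, rfl⟩
    refine Fin.cases ?_ (fun j => ?_) j
    · exact ⟨k, Ideal.mem_sup_left ((Ideal.mem_torsionOf_iff _ _).2 hk)⟩
    · exact Ideal.le_radical (Ideal.mem_sup_right (Ideal.subset_span ⟨j, rfl⟩))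

theorem IsSystem.ker {d : ℕ} {z : Fin (d + 1) → R} (h : IsSystem I z N) :
    IsSystem I (Fin.tail z) (LinearMap.ker (locMap (z 0) N)) := by
  refine h.tail fun x => ?_
  obtain ⟨k, hk⟩ := exists_pow_smul_eq_zero_of_mem_ker x.2
  refine ⟨x, k, fun r hr => ?_, Subtype.ext hk⟩
  rw [Ideal.mem_torsionOf_iff] at hr ⊢
  exact Subtype.ext hr

theorem IsSystem.locCoker {d : ℕ} {z : Fin (d + 1) → R} (h : IsSystem I z N) :
    IsSystem I (Fin.tail z) (LocCoker (z 0) N) :=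
  h.tail exists_torsionOf_le_locCoker

theorem IsSystem.powTorsion_eq_top [IsNoetherianRing R] {z : Fin 0 → R} (h : IsSystem I z N) :
    powTorsion I N = ⊤ := by
  rw [eq_top_iff]
  intro n _
  have := h n
  rw [Set.range_eq_empty, Ideal.span_empty, sup_bot_eq] at this
  obtain ⟨k, hk⟩ := Ideal.exists_pow_le_of_le_radical_of_fg this (IsNoetherian.noetherian I)
  exact ⟨k, fun r hr => (Ideal.mem_torsionOf_iff _ _).1 (hk hr)⟩

/-- Induction on `d`: the kernel and cokernel of localization at `z 0` are governed by the remaining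
`d - 1` elements, and only the cokernel shifts the degree, by one. -/
theorem IsSystem.localCohomologyVanishes [IsNoetherianRing R] {d : ℕ} {z : Fin d → R}
    (hz : ∀ j, z j ∈ I) (h : IsSystem I z N) {i : ℕ} (hi : d < i) :
    LocalCohomologyVanishes I N i := by
  induction d generalizing N i with
  | zero =>
    obtain ⟨i, rfl⟩ : ∃ j, i = j + 1 := ⟨i - 1, by omega⟩
    exact localCohomologyVanishes_succ_of_torsion h.powTorsion_eq_top i
  | succ d ih =>
    obtain ⟨i, rfl⟩ : ∃ j, i = j + 1 := ⟨i - 1, by omega⟩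
    exact LocalCohomologyVanishes.of_localization (hz 0) (ih (fun j => hz j.succ) h.ker (by omega))
      (ih (fun j => hz j.succ) h.locCoker (by omega))

/-- The residue along `z` of a map from `N` to polynomials in one variable on which `z` acts as
the variable: the coefficient of `X⁻¹`, as a map on `N_z / N`. -/
theorem exists_residue {A : Type*} [CommRing A] {z : R} (φ : N →+ Polynomial A)
    (hφ : ∀ n, φ (z • n) = Polynomial.X * φ n) :
    ∃ ψ : LocCoker z N →+ A, ∀ (x : LocAway z N) (n : N) (t : ℕ), z ^ t • x = locMap z N n →
      ψ (Submodule.Quotient.mk x) = (φ (z • n)).coeff t := by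
  have hpow : ∀ (k : ℕ) (n : N), φ (z ^ k • n) = Polynomial.X ^ k * φ n := by
    intro k
    induction k with
    | zero => intro n; simp
    | succ k ih => intro n; rw [pow_succ', mul_smul, hφ, ih, pow_succ', mul_assoc]
  have hshift : ∀ (k t : ℕ) (n : N), (φ (z ^ k • n)).coeff (t + k) = (φ n).coeff t := by
    intro k t n
    rw [hpow, Polynomial.coeff_X_pow_mul]
  have hwd : ∀ (x : LocAway z N) (n n' : N) (t t' : ℕ), z ^ t • x = locMap z N n →
      z ^ t' • x = locMap z N n' → (φ (z • n)).coeff t = (φ (z • n')).coeff t' := by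
    intro x n n' t t' h h'
    have : locMap z N (z ^ t' • n) = locMap z N (z ^ t • n') := by
      rw [map_smul, map_smul, ← h, ← h', smul_comm]
    obtain ⟨k, hk⟩ := locMap_eq_iff.1 this
    rw [← mul_smul, ← mul_smul, ← pow_add, ← pow_add] at hk
    rw [← hshift (k + t') t, ← hshift (k + t) t', smul_comm, hk, smul_comm]
    congr 1
    omega
  choose num ex hnum using exists_pow_smul_eq_locMap (z := z) (N := N)
  -- For `x = n / z ^ t` the coefficient of `X⁻¹` in `φ n / X ^ t` has index `t - 1` in `φ n`;
  -- multiplying `n` by `z` makes the index `t`, which also covers `t = 0`.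
  let ψ₀ : LocAway z N →+ A :=
    { toFun := fun x => (φ (z • num x)).coeff (ex x)
      map_zero' := (hwd 0 _ 0 _ 0 (hnum 0) (by simp)).trans (by simp)
      map_add' := by
        intro x y
        rw [hwd (x + y) _ (z ^ ex y • num x + z ^ ex x • num y) _ (ex x + ex y) (hnum _)]
        · rw [smul_add, map_add, Polynomial.coeff_add, smul_comm, hshift, smul_comm z,
            add_comm (ex x), hshift]
        · rw [map_add, map_smul, map_smul, ← hnum, ← hnum, smul_add, pow_add, mul_smul, mul_smul,
            smul_comm (z ^ ex x)] }
  refine ⟨QuotientAddGroup.lift (LinearMap.range (locMap z N)).toAddSubgroup ψ₀ ?_, ?_⟩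
  · rintro _ ⟨n, rfl⟩
    refine (hwd _ _ n _ 0 (hnum _) (by simp)).trans ?_
    rw [hφ, Polynomial.coeff_X_mul_zero]
  · intro x n t h
    exact hwd x _ n _ t (hnum x) h

/-- Induction on `d`. If `H^{d+1}(N)` vanished, so would `H^d(N_z / N)` for `z = z 0`, as the kernel
has no cohomology in degree `d + 2`; but the residue of `φ` is a nonzero map of the same kind on
`N_z / N`. For `d = 0` the module is torsion, so vanishing of `H^0` would force `N = 0`. -/
theorem IsSystem.not_localCohomologyVanishes [IsNoetherianRing R] {K : Type*} [Field K] {d : ℕ}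
    {z : Fin d → R} (hz : ∀ j, z j ∈ I) (h : IsSystem I z N)
    (φ : N →+ MvPolynomial (Fin d) K) (hφ : ∀ j n, φ (z j • n) = MvPolynomial.X j * φ n)
    (hne : φ ≠ 0) : ¬ LocalCohomologyVanishes I N d := by
  induction d generalizing N with
  | zero =>
    intro hV
    apply hne
    ext1 n
    obtain ⟨k, hk⟩ : n ∈ powTorsion I N := h.powTorsion_eq_top ▸ trivial
    rw [localCohomologyVanishes_zero_iff.1 hV n k hk, map_zero, map_zero]
  | succ d ih =>
    intro hV
    let φ' : N →+ Polynomial (MvPolynomial (Fin d) K) :=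
      (MvPolynomial.finSuccEquiv K d).toRingEquiv.toAddEquiv.toAddMonoidHom.comp φ
    have hφ0 : ∀ n, φ' (z 0 • n) = Polynomial.X * φ' n := by
      intro n
      change MvPolynomial.finSuccEquiv K d (φ _) = _ * MvPolynomial.finSuccEquiv K d (φ _)
      rw [hφ, map_mul, MvPolynomial.finSuccEquiv_X_zero]
    have hφs : ∀ j n, φ' (z (Fin.succ j) • n) = Polynomial.C (MvPolynomial.X j) * φ' n := by
      intro j n
      change MvPolynomial.finSuccEquiv K d (φ _) = _ * MvPolynomial.finSuccEquiv K d (φ _)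
      rw [hφ, map_mul, MvPolynomial.finSuccEquiv_X_succ]
    obtain ⟨ψ, hψ⟩ := exists_residue φ' hφ0
    refine ih (fun j => hz j.succ) h.locCoker ψ ?_ ?_
      (LocalCohomologyVanishes.locCoker (hz 0)
        (h.ker.localCohomologyVanishes (fun j => hz j.succ) (by omega)) hV)
    · intro j x
      obtain ⟨x, rfl⟩ := Submodule.Quotient.mk_surjective _ x
      obtain ⟨n, t, hn⟩ := exists_pow_smul_eq_locMap x
      have h2 : z 0 ^ t • (z j.succ • x) = locMap (z 0) N (z j.succ • n) := by
        rw [smul_comm, hn, map_smul]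
      rw [← Submodule.Quotient.mk_smul]
      refine (hψ _ _ t h2).trans ?_
      rw [hψ x n t hn, smul_comm, hφs, Polynomial.coeff_C_mul]
    · intro h0
      apply hne
      ext1 n
      apply (MvPolynomial.finSuccEquiv K d).injective
      change φ' n = MvPolynomial.finSuccEquiv K d 0
      rw [map_zero]
      ext1 k
      -- The coefficient of index `k` of `φ' n` is the residue at `n / z_0 ^ (k + 1)`, so zero
      -- residues force `φ = 0`.
      obtain ⟨x, hx⟩ : ∃ x : LocAway (z 0) N, z 0 ^ (k + 1) • x = locMap (z 0) N n := by
        have hs : ∀ (t : ℕ) (y : LocAway (z 0) N), ∃ x : LocAway (z 0) N, z 0 ^ t • x = y := by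
          intro t
          induction t with
          | zero => intro y; exact ⟨y, by simp⟩
          | succ t ih =>
            intro y
            obtain ⟨x, rfl⟩ := lsmul_locAway_bijective.2 y
            obtain ⟨x, rfl⟩ := ih x
            exact ⟨x, by rw [pow_succ', mul_smul]; rfl⟩
        exact hs _ _
      have := hψ x n (k + 1) hx
      rw [h0, hφ0, Polynomial.coeff_X_mul] at this
      rw [← this, Polynomial.coeff_zero]; rfl

end Systems

/-! ### Modules with a single nonzero local cohomology module -/

section Concentrated

variable {R : Type u} [CommRing R] {I : Ideal R}

/-- The local cohomology of `N` with support in `I` is concentrated in degree `q` and nonzero. -/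
structure IsConcentrated (I : Ideal R) (N : Type u) [AddCommGroup N] [Module R N] (q : ℕ) :
    Prop where
  vanishes : ∀ i ≠ q, LocalCohomologyVanishes I N i
  not_vanishes : ¬ LocalCohomologyVanishes I N q

variable {N : Type u} [AddCommGroup N] [Module R N] {q : ℕ}

theorem localCohomologyVanishes_of_subsingleton [Subsingleton N] (i : ℕ) :
    LocalCohomologyVanishes I N i :=
  localCohomologyVanishes_of_bijective (zero_mem I)
    ⟨Function.injective_of_subsingleton _, fun w => ⟨w, Subsingleton.elim _ _⟩⟩

theorem localCohomologyVanishes_zero_of_isSMulRegular {a : R} (ha : a ∈ I)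
    (h : IsSMulRegular N a) : LocalCohomologyVanishes I N 0 := by
  rw [localCohomologyVanishes_zero_iff]
  intro n t hn
  refine (h.pow t) ?_
  change a ^ t • n = a ^ t • 0
  rw [hn _ (Ideal.pow_mem_pow ha t), smul_zero]

theorem nontrivial_H_iff (i : ℕ) : Nontrivial (H I N i) ↔ ¬ LocalCohomologyVanishes I N i := by
  rw [← subsingleton_H_iff, not_subsingleton_iff_nontrivial]

theorem IsConcentrated.nontrivial (h : IsConcentrated I N q) : Nontrivial N := by
  by_contra hN
  have := not_nontrivial_iff_subsingleton.1 hN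
  exact h.not_vanishes (localCohomologyVanishes_of_subsingleton q)

theorem IsConcentrated.isRelativeCM (h : IsConcentrated I N q) : IsRelativeCM I N :=
  ⟨q, fun i hi => (subsingleton_H_iff I N i).2 (h.vanishes i (by exact_mod_cast hi))⟩

theorem IsConcentrated.cd_eq (h : IsConcentrated I N q) : cd I N = ((q : ℕ∞) : WithBot ℕ∞) := by
  refine le_antisymm (iSup₂_le fun i hi => ?_)
    (le_iSup₂_of_le q ((nontrivial_H_iff q).2 h.not_vanishes) le_rfl)
  by_cases hiq : i = q
  · rw [hiq]
  · exact absurd (h.vanishes i hiq) ((nontrivial_H_iff i).1 hi)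

/-- The condition `0 ≤ cd` excludes the value `⊥`, so some `H^i` is nonzero, and its degree must be
the given integer. -/
theorem IsRelativeCM.exists_isConcentrated (h : IsRelativeCM I N) (h0 : 0 ≤ cd I N) :
    ∃ q, IsConcentrated I N q := by
  obtain ⟨q, hq⟩ := h
  have hex : ∃ i, Nontrivial (H I N i) := by
    by_contra hcon
    push Not at hcon
    have : cd I N = ⊥ := by
      rw [cd, eq_bot_iff]
      refine iSup₂_le fun i hi => ?_
      have hi' : Nontrivial (H I N i) := hi
      exact absurd hi' (not_nontrivial_iff_subsingleton.2 (hcon i))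
    rw [this] at h0
    exact absurd h0 (by decide)
  obtain ⟨i, hi⟩ := hex
  have hiq : (i : ℤ) = q := by
    by_contra hne
    exact not_subsingleton_iff_nontrivial.2 hi (hq i hne)
  refine ⟨i, fun j hj => (subsingleton_H_iff I N j).1 (hq j ?_), (nontrivial_H_iff i).1 hi⟩
  rw [← hiq]
  exact_mod_cast hj

/-- Otherwise the element whose annihilator is `p` would be a nonzero element killed by `I`,
contradicting `H^0 = 0`. -/
theorem not_le_of_mem_associatedPrimes [IsNoetherianRing R] (h : LocalCohomologyVanishes I N 0)
    {p : Ideal R} (hp : p ∈ associatedPrimes R N) : ¬ I ≤ p := by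
  intro hIp
  obtain ⟨hprime, x, rfl⟩ := isAssociatedPrime_iff.1 hp
  refine hprime.ne_top ?_
  have hx : x = 0 := by
    refine localCohomologyVanishes_zero_iff.1 h x 1 fun r hr => ?_
    rw [pow_one] at hr
    simpa using hIp hr
  simp [hx]

theorem exists_isSMulRegular_of_grade_pos (h : 0 < grade I N) : ∃ a ∈ I, IsSMulRegular N a := by
  by_contra hcon
  push Not at hcon
  refine absurd h (not_lt.2 (iSup₂_le ?_))
  rintro (_ | ⟨a, as⟩) ⟨has, hreg⟩
  · simp
  · exact absurd ((RingTheory.Sequence.isWeaklyRegular_cons_iff N a as).1 hreg).1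
      (hcon a (has a List.mem_cons_self))

end Concentrated

end LocalCohomology

/-- A maximal independent set of generators spans a free module containing `f B` for some `f ≠ 0`.
By faithfulness `f B ≠ 0`, so some coordinate composed with multiplication by `f` is nonzero. -/
theorem exists_ne_zero_dual {A B : Type*} [CommRing A] [IsDomain A] [AddCommGroup B] [Module A B]
    [Module.Finite A B] (h : ∀ a : A, (∀ b : B, a • b = 0) → a = 0) :
    ∃ φ : B →ₗ[A] A, φ ≠ 0 := by
  classical
  obtain ⟨G, hG⟩ := Module.finite_def.1 (inferInstance : Module.Finite A B)
  obtain ⟨s, hs, hmax⟩ := exists_maximal_linearIndepOn A (fun g : G => (g : B))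
  have hex : ∀ g : G, ∃ a : A, a ≠ 0 ∧
      a • (g : B) ∈ Submodule.span A ((fun g : G => (g : B)) '' s) := by
    intro g
    by_cases hg : g ∈ s
    · exact ⟨1, one_ne_zero, by rw [one_smul]; exact Submodule.subset_span ⟨g, hg, rfl⟩⟩
    · exact hmax g hg
  choose a ha0 ha using hex
  have hf0 : ∏ g, a g ≠ 0 := Finset.prod_ne_zero_iff.2 fun g _ => ha0 g
  set f := ∏ g, a g with hf
  have hmem : ∀ b : B, f • b ∈ Submodule.span A ((fun g : G => (g : B)) '' s) := by
    intro b
    have hb : b ∈ Submodule.span A (G : Set B) := hG ▸ trivial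
    induction hb using Submodule.span_induction with
    | mem g hg =>
      obtain ⟨c, hc⟩ := Finset.dvd_prod_of_mem a (Finset.mem_univ (⟨g, hg⟩ : G))
      rw [hf, hc, mul_comm, mul_smul]
      exact Submodule.smul_mem _ _ (ha ⟨g, hg⟩)
    | zero => rw [smul_zero]; exact zero_mem _
    | add x y _ _ hx hy => rw [smul_add]; exact add_mem hx hy
    | smul c x _ hx => rw [smul_comm]; exact Submodule.smul_mem _ _ hx
  have hne : ∃ b : B, f • b ≠ 0 := by
    by_contra hcon
    push Not at hcon
    exact hf0 (h f hcon)
  obtain ⟨b, hb⟩ := hne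
  have hs' : LinearIndependent A (fun x : s => ((x : G) : B)) := hs
  have hspan : Submodule.span A ((fun g : G => (g : B)) '' s) =
      Submodule.span A (Set.range (fun x : s => ((x : G) : B))) := by
    rw [Set.image_eq_range]
  rw [hspan] at hmem
  let ψ : B →ₗ[A] Submodule.span A (Set.range (fun x : s => ((x : G) : B))) :=
    (LinearMap.lsmul A B f).codRestrict _ hmem
  have hψ : hs'.repr (ψ b) ≠ 0 := by
    intro h0
    have h1 : ψ b = 0 := LinearMap.ker_eq_bot'.1 hs'.repr_ker _ h0
    exact hb (congrArg Subtype.val h1)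
  obtain ⟨i, hi⟩ := Finsupp.ne_iff.1 hψ
  refine ⟨(Finsupp.lapply i).comp (hs'.repr.comp ψ), fun h0 => hi ?_⟩
  exact LinearMap.congr_fun h0 b

section Bigraded

variable {K : Type u} [Field K] {m n : ℕ}

/-! ### Homogeneous components and bigraded submodules -/

section Grading

variable {M : Type u} [AddCommGroup M] [Module (S K m n) M] {ℳ : ℤ × ℤ → AddSubgroup M}

theorem exists_projections (h : DirectSum.IsInternal ℳ) :
    ∃ π : ℤ × ℤ → M →+ M, (∀ d, ∀ x ∈ ℳ d, π d x = x) ∧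
      (∀ d e, ∀ x ∈ ℳ e, e ≠ d → π d x = 0) ∧ (∀ d x, π d x ∈ ℳ d) ∧
      (∀ x, (∀ d, π d x = 0) → x = 0) := by
  classical
  let D : DirectSum.Decomposition ℳ := h.chooseDecomposition
  refine ⟨fun d =>
    { toFun := fun x => (DirectSum.decompose ℳ x d : M)
      map_zero' := by simp
      map_add' := fun x y => by simp }, ?_, ?_, ?_, ?_⟩
  · intro d x hx
    exact DirectSum.decompose_of_mem_same ℳ hx
  · intro d e x hx hed
    exact DirectSum.decompose_of_mem_ne ℳ hx hed
  · intro d x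
    exact (DirectSum.decompose ℳ x d).2
  · intro x hx
    rw [← DirectSum.sum_support_decompose ℳ x]
    exact Finset.sum_eq_zero fun d _ => hx d

theorem IsBigrading.induction (h : IsBigrading K m n ℳ) {P : M → Prop} (h0 : P 0)
    (hadd : ∀ x y, P x → P y → P (x + y)) (hhom : ∀ d, ∀ x ∈ ℳ d, P x) (x : M) : P x := by
  classical
  let D : DirectSum.Decomposition ℳ := h.internal.chooseDecomposition
  exact DirectSum.Decomposition.inductionOn ℳ h0 (fun x => hhom _ x x.2) hadd x

theorem IsBigrading.projection_smul (h : IsBigrading K m n ℳ) {π : ℤ × ℤ → M →+ M}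
    (h1 : ∀ d, ∀ x ∈ ℳ d, π d x = x) (h2 : ∀ d e, ∀ x ∈ ℳ e, e ≠ d → π d x = 0)
    (f : S K m n) {d e : ℤ × ℤ} {x : M} (hx : x ∈ ℳ e) :
    π (d + e) (f • x) =
      MvPolynomial.weightedHomogeneousComponent (bidegree m n) d f • x := by
  classical
  induction f using MvPolynomial.induction_on' with
  | add p q hp hq => rw [add_smul, map_add, hp, hq, map_add, add_smul]
  | monomial s a =>
    have hmem := MvPolynomial.isWeightedHomogeneous_monomial (bidegree m n) s a rfl
    have hmem' := h.smul_mem hmem hx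
    rw [MvPolynomial.weightedHomogeneousComponent_of_mem hmem]
    split_ifs with hd
    · subst hd; exact h1 _ _ hmem'
    · rw [zero_smul]
      exact h2 _ _ _ hmem' fun h' => hd (add_right_cancel h').symm

theorem IsBigrading.component_mem_annihilator (h : IsBigrading K m n ℳ) {f : S K m n}
    (hf : f ∈ Module.annihilator (S K m n) M) (d : ℤ × ℤ) :
    MvPolynomial.weightedHomogeneousComponent (bidegree m n) d f ∈
      Module.annihilator (S K m n) M := by
  obtain ⟨π, h1, h2, -, -⟩ := exists_projections h.internal
  rw [Module.mem_annihilator] at hf ⊢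
  intro x
  refine h.induction
    (P := fun x => MvPolynomial.weightedHomogeneousComponent (bidegree m n) d f • x = 0)
    (smul_zero _) (fun x y hx hy => by rw [smul_add, hx, hy, add_zero]) ?_ x
  intro e x hx
  rw [← h.projection_smul h1 h2 f hx, hf x, map_zero]

theorem isBigradedSubmodule_of_homogeneous_span (h : IsBigrading K m n ℳ) {A : Set M}
    (hA : ∀ x ∈ A, ∃ d, x ∈ ℳ d) : IsBigradedSubmodule ℳ (Submodule.span (S K m n) A) := by
  refine le_antisymm ?_ (iSup_le fun e => inf_le_right)
  intro x hx
  refine Submodule.span_induction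
    (p := fun x _ => x ∈ ⨆ d, ℳ d ⊓ (Submodule.span (S K m n) A).toAddSubgroup)
    ?_ (zero_mem _) (fun x y _ _ hx hy => add_mem hx hy) ?_ hx
  · intro x hx
    obtain ⟨d, hd⟩ := hA x hx
    exact AddSubgroup.mem_iSup_of_mem d ⟨hd, Submodule.subset_span hx⟩
  · intro f x _ hx
    refine AddSubgroup.iSup_induction
      (C := fun x => f • x ∈ ⨆ d, ℳ d ⊓ (Submodule.span (S K m n) A).toAddSubgroup) _ hx ?_
      (by simp) (fun x y hx hy => by rw [smul_add]; exact add_mem hx hy)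
    rintro e x ⟨hx, hxA⟩
    induction f using MvPolynomial.induction_on' with
    | add p q hp hq => rw [add_smul]; exact add_mem hp hq
    | monomial s a =>
      exact AddSubgroup.mem_iSup_of_mem _
        ⟨h.smul_mem (MvPolynomial.isWeightedHomogeneous_monomial (bidegree m n) s a rfl) hx,
          Submodule.smul_mem _ _ hxA⟩

/-- An ideal generated by bihomogeneous elements sends `M` to a bigraded submodule. -/
theorem IsBigrading.isBigradedSubmodule_span_smul_top (h : IsBigrading K m n ℳ) {A : Set (S K m n)}
    (hA : ∀ f ∈ A, ∃ d, f ∈ component K m n d) :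
    IsBigradedSubmodule ℳ (Ideal.span A • (⊤ : Submodule (S K m n) M)) := by
  have htop : (⊤ : Submodule (S K m n) M) = Submodule.span _ {x | ∃ d, x ∈ ℳ d} := by
    refine (eq_top_iff.2 fun x _ => ?_).symm
    exact h.induction (P := (· ∈ Submodule.span (S K m n) {x | ∃ d, x ∈ ℳ d})) (zero_mem _)
      (fun x y hx hy => add_mem hx hy) (fun d x hx => Submodule.subset_span ⟨d, hx⟩) x
  rw [htop, Submodule.span_smul_span]
  refine isBigradedSubmodule_of_homogeneous_span h ?_
  rintro _ ⟨f, hf, x, ⟨e, hx⟩, rfl⟩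
  obtain ⟨d, hd⟩ := hA f hf
  exact ⟨d + e, h.smul_mem hd hx⟩

theorem IsBigrading.exists_homogeneous_generators [Module.Finite (S K m n) M]
    (h : IsBigrading K m n ℳ) :
    ∃ G : Finset M, Submodule.span (S K m n) (G : Set M) = ⊤ ∧ ∀ g ∈ G, ∃ d, g ∈ ℳ d := by
  have htop : Submodule.span (S K m n) {x | ∃ d, x ∈ ℳ d} = ⊤ := by
    refine eq_top_iff.2 fun x _ => ?_
    exact h.induction (P := (· ∈ Submodule.span (S K m n) {x | ∃ d, x ∈ ℳ d})) (zero_mem _)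
      (fun x y hx hy => add_mem hx hy) (fun d x hx => Submodule.subset_span ⟨d, hx⟩) x
  have hfg : (Submodule.span (S K m n) {x | ∃ d, x ∈ ℳ d}).FG := htop ▸ Module.Finite.fg_top
  obtain ⟨G, hG, hG'⟩ := Submodule.fg_span_iff_fg_span_finset_subset _ |>.1 hfg
  exact ⟨G, hG'.symm.trans htop, fun g hg => hG hg⟩

end Grading

/-! ### Induced bigradings on submodules and quotients -/

section Subquotients

variable {M : Type u} [AddCommGroup M] [Module (S K m n) M] {ℳ : ℤ × ℤ → AddSubgroup M}

/-- The induced bigrading of a submodule. -/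
noncomputable def subBigrading (ℳ : ℤ × ℤ → AddSubgroup M) (N : Submodule (S K m n) M) :
    ℤ × ℤ → AddSubgroup N :=
  fun d => (ℳ d).comap N.subtype.toAddMonoidHom

theorem IsBigrading.sub (h : IsBigrading K m n ℳ) {N : Submodule (S K m n) M}
    (hN : IsBigradedSubmodule ℳ N) : IsBigrading K m n (subBigrading ℳ N) := by
  classical
  refine ⟨⟨?_, ?_⟩, fun d e f z hf hz => h.smul_mem hf hz⟩
  · let ι : ∀ d, subBigrading ℳ N d →+ ℳ d := fun d =>
      { toFun := fun x => ⟨x.1.1, x.2⟩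
        map_zero' := rfl
        map_add' := fun _ _ => rfl }
    have hcomp : N.subtype.toAddMonoidHom.comp (DirectSum.coeAddMonoidHom (subBigrading ℳ N)) =
        (DirectSum.coeAddMonoidHom ℳ).comp (DirectSum.map ι) := by
      ext d x
      simp [ι]
    have hinj : Function.Injective (DirectSum.map ι) := by
      rw [DirectSum.map_injective]
      intro d x y hxy
      exact Subtype.ext (Subtype.ext (congrArg (fun z : ℳ d => (z : M)) hxy))
    have : Function.Injective (N.subtype.toAddMonoidHom.comp
        (DirectSum.coeAddMonoidHom (subBigrading ℳ N))) := by
      rw [hcomp]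
      exact h.internal.1.comp hinj
    exact Function.Injective.of_comp (f := N.subtype) this
  · rintro ⟨x, hx⟩
    have hx' : x ∈ ⨆ d, ℳ d ⊓ N.toAddSubgroup := hN ▸ hx
    suffices ∃ y, N.subtype (DirectSum.coeAddMonoidHom (subBigrading ℳ N) y) = x by
      obtain ⟨y, hy⟩ := this
      exact ⟨y, Subtype.ext hy⟩
    refine AddSubgroup.iSup_induction
      (C := fun x => ∃ y, N.subtype (DirectSum.coeAddMonoidHom (subBigrading ℳ N) y) = x)
      _ hx' ?_ ⟨0, by simp⟩ ?_
    · rintro d x ⟨hx, hxN⟩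
      exact ⟨DirectSum.of (fun d => subBigrading ℳ N d) d ⟨⟨x, hxN⟩, hx⟩, by simp⟩
    · rintro _ _ ⟨x, rfl⟩ ⟨y, rfl⟩
      exact ⟨x + y, by simp⟩

theorem IsBigradedSubmodule.submoduleOf {A B : Submodule (S K m n) M} (hAB : A ≤ B)
    (hA : IsBigradedSubmodule ℳ A) : IsBigradedSubmodule (subBigrading ℳ B) (A.submoduleOf B) := by
  refine le_antisymm ?_ (iSup_le fun e => inf_le_right)
  rintro ⟨x, hxB⟩ hxA
  have hx' : x ∈ ⨆ d, ℳ d ⊓ A.toAddSubgroup := hA ▸ hxA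
  suffices ∃ h : x ∈ B, (⟨x, h⟩ : B) ∈
      ⨆ d, subBigrading ℳ B d ⊓ (A.submoduleOf B).toAddSubgroup from this.2
  refine AddSubgroup.iSup_induction (C := fun x => ∃ h : x ∈ B, (⟨x, h⟩ : B) ∈
      ⨆ d, subBigrading ℳ B d ⊓ (A.submoduleOf B).toAddSubgroup) _ hx' ?_ ?_ ?_
  · rintro d x ⟨hx, hxA⟩
    exact ⟨hAB hxA, AddSubgroup.mem_iSup_of_mem d ⟨hx, hxA⟩⟩
  · exact ⟨zero_mem _, zero_mem _⟩
  · rintro x y ⟨hx, hx'⟩ ⟨hy, hy'⟩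
    exact ⟨add_mem hx hy, add_mem hx' hy'⟩

/-- A bigraded submodule maps to a bigraded submodule of a quotient. -/
theorem IsBigradedSubmodule.map_mkQ {A : Submodule (S K m n) M} (hA : IsBigradedSubmodule ℳ A)
    (N : Submodule (S K m n) M) :
    IsBigradedSubmodule (quotientBigrading ℳ N) (A.map N.mkQ) := by
  refine le_antisymm ?_ (iSup_le fun e => inf_le_right)
  rintro _ ⟨x, hxA, rfl⟩
  have hx' : x ∈ ⨆ d, ℳ d ⊓ A.toAddSubgroup := hA ▸ hxA
  refine AddSubgroup.iSup_induction (C := fun x => N.mkQ x ∈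
    ⨆ d, quotientBigrading ℳ N d ⊓ (A.map N.mkQ).toAddSubgroup) _ hx' ?_ ?_ ?_
  · rintro d x ⟨hx, hxA⟩
    exact AddSubgroup.mem_iSup_of_mem d ⟨⟨x, hx, rfl⟩, ⟨x, hxA, rfl⟩⟩
  · rw [map_zero]; exact zero_mem _
  · intro x y hx hy
    rw [map_add]; exact add_mem hx hy

end Subquotients

/-! ### A graded Nakayama lemma -/

section Degrees

variable {M : Type u} [AddCommGroup M] [Module (S K m n) M] {ℳ : ℤ × ℤ → AddSubgroup M}

variable (K m n) in
/-- The ideal `(x₁, …, x_m)`. -/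
noncomputable def xIdeal : Ideal (S K m n) :=
  Ideal.span (Set.range fun i : Fin m => MvPolynomial.X (Sum.inl i))

theorem X_inl_mem_component (i : Fin m) :
    (MvPolynomial.X (Sum.inl i) : S K m n) ∈ component K m n (1, 0) :=
  MvPolynomial.isWeightedHomogeneous_X K (bidegree m n) (Sum.inl i)

theorem X_inr_mem_component (j : Fin n) :
    (MvPolynomial.X (Sum.inr j) : S K m n) ∈ component K m n (0, 1) :=
  MvPolynomial.isWeightedHomogeneous_X K (bidegree m n) (Sum.inr j)

theorem span_pow_le_span_component {A : Set (S K m n)} {δ : ℤ × ℤ}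
    (hA : ∀ f ∈ A, f ∈ component K m n δ) (s : ℕ) :
    Ideal.span A ^ s ≤
      Ideal.span {f : S K m n | f ∈ component K m n (s • δ) ∧ f ∈ Ideal.span A ^ s} := by
  induction s with
  | zero =>
    rw [pow_zero, Ideal.one_eq_top, top_le_iff, Ideal.eq_top_iff_one]
    refine Ideal.subset_span ?_
    rw [Set.mem_ofPred_eq, zero_smul]
    exact ⟨MvPolynomial.isWeightedHomogeneous_one K (bidegree m n), by simp⟩
  | succ s ih =>
    rw [pow_succ]
    refine (Ideal.mul_mono ih (le_refl (Ideal.span A))).trans ?_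
    rw [Ideal.span_mul_span']
    refine Ideal.span_mono ?_
    rintro _ ⟨f, hf, g, hg, rfl⟩
    rw [Set.mem_ofPred_eq, add_smul, one_smul]
    exact ⟨MvPolynomial.IsWeightedHomogeneous.mul hf.1 (hA g hg),
      Ideal.mul_mem_mul hf.2 (Ideal.subset_span hg)⟩

theorem weight_bidegree_nonneg (s : Fin m ⊕ Fin n →₀ ℕ) :
    0 ≤ Finsupp.weight (bidegree m n) s := by
  rw [Finsupp.weight_apply]
  refine Finsupp.sum_nonneg' fun i => nsmul_nonneg ?_ _
  rcases i with i | i <;> simp [bidegree, Prod.le_def]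

theorem weightedHomogeneousComponent_eq_zero_of_neg (f : S K m n) {d : ℤ × ℤ} (hd : d.1 < 0) :
    MvPolynomial.weightedHomogeneousComponent (bidegree m n) d f = 0 := by
  classical
  ext s
  rw [MvPolynomial.coeff_weightedHomogeneousComponent, if_neg, MvPolynomial.coeff_zero]
  rintro rfl
  exact absurd (weight_bidegree_nonneg s).1 (not_le.2 hd)

theorem IsBigrading.eq_zero_of_mem_span (h : IsBigrading K m n ℳ) {c : ℤ} {d : ℤ × ℤ}
    (hd : d.1 < c) {x : M} (hx : x ∈ ℳ d)
    (hx' : x ∈ Submodule.span (S K m n) {x | ∃ e : ℤ × ℤ, c ≤ e.1 ∧ x ∈ ℳ e}) : x = 0 := by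
  obtain ⟨π, h1, h2, -, -⟩ := exists_projections h.internal
  rw [← h1 d x hx]
  refine Submodule.closure_induction (p := fun x _ => π d x = 0) (map_zero _)
    (fun x y _ _ hx hy => by rw [map_add, hx, hy, add_zero]) ?_ hx'
  rintro f x ⟨e, he, hx⟩
  have := h.projection_smul h1 h2 f (d := d - e) hx
  rw [sub_add_cancel] at this
  rw [this, weightedHomogeneousComponent_eq_zero_of_neg, zero_smul]
  rw [Prod.fst_sub]; omega

theorem pow_smul_top_le {J : Type*} [CommRing J] {N : Type*} [AddCommGroup N] [Module J N]
    {I P : Ideal J} (h : I • (⊤ : Submodule J N) ≤ P • ⊤) (a : ℕ) :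
    I ^ a • (⊤ : Submodule J N) ≤ P ^ a • ⊤ := by
  induction a with
  | zero => simp
  | succ a ih =>
    rw [pow_succ, Submodule.mul_smul]
    refine (Submodule.smul_mono le_rfl h).trans ?_
    rw [← Submodule.mul_smul, mul_comm, Submodule.mul_smul, pow_succ', Submodule.mul_smul]
    exact Submodule.smul_mono le_rfl ih

/-- A graded Nakayama lemma: if `Q ^ k M ⊆ (x) M` then `M` is killed by a power of `Q ^ k`. -/
theorem IsBigrading.exists_pow_smul_top_eq_bot [Module.Finite (S K m n) M]
    (h : IsBigrading K m n ℳ) {k : ℕ}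
    (hk : Q K m n ^ k • (⊤ : Submodule (S K m n) M) ≤ xIdeal K m n • ⊤) :
    ∃ a, Q K m n ^ (k * a) • (⊤ : Submodule (S K m n) M) = ⊥ := by
  classical
  obtain ⟨G, hG, hdeg⟩ := h.exists_homogeneous_generators
  choose! deg hdeg using hdeg
  obtain ⟨b, hb⟩ := (G.image fun g => (deg g).1).exists_le
  obtain ⟨c, hc⟩ := (G.image fun g => -(deg g).1).exists_le
  have hb : ∀ g ∈ G, (deg g).1 ≤ b := fun g hg => hb _ (Finset.mem_image_of_mem _ hg)
  have hc : ∀ g ∈ G, -c ≤ (deg g).1 := fun g hg => by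
    have := hc _ (Finset.mem_image_of_mem _ hg); omega
  -- The generators have `x`-degrees in `[-c, b]`. Since `a > b + c`, the submodule `(x) ^ a M`
  -- lives in `x`-degrees above `b`, while `Q ^ (k * a) M` is generated in `x`-degrees at most `b`.
  refine ⟨(b + c + 1).toNat, ?_⟩
  set a := (b + c + 1).toNat
  have ha : b + c + 1 ≤ a := Int.self_le_toNat _
  have hx : xIdeal K m n ^ a • (⊤ : Submodule (S K m n) M) ≤
      Submodule.span (S K m n) {x | ∃ e : ℤ × ℤ, -c + a ≤ e.1 ∧ x ∈ ℳ e} := by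
    refine (Submodule.smul_mono (span_pow_le_span_component (δ := (1, 0)) ?_ a) le_rfl).trans ?_
    · rintro _ ⟨i, rfl⟩; exact X_inl_mem_component i
    · rw [← hG, Submodule.span_smul_span]
      refine Submodule.span_mono ?_
      rintro _ ⟨f, hf, g, hg, rfl⟩
      refine ⟨_, ?_, h.smul_mem hf.1 (hdeg g hg)⟩
      have := hc g hg
      simp; omega
  have hy : Q K m n ^ (k * a) • (⊤ : Submodule (S K m n) M) ≤ Submodule.span (S K m n)
      ({f : S K m n | f ∈ component K m n ((k * a) • (0, 1)) ∧ f ∈ Q K m n ^ (k * a)} • (G : Set M)) := by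
    refine (Submodule.smul_mono
      (span_pow_le_span_component (δ := (0, 1)) ?_ (k * a)) le_rfl).trans ?_
    · rintro _ ⟨i, rfl⟩; exact X_inr_mem_component i
    · rw [← hG, Submodule.span_smul_span]; rfl
  rw [eq_bot_iff]
  refine hy.trans (Submodule.span_le.2 ?_)
  rintro _ ⟨f, hf, g, hg, rfl⟩
  refine h.eq_zero_of_mem_span (c := -c + a) ?_ (h.smul_mem hf.1 (hdeg g hg)) (hx ?_)
  · have := hb g hg
    simp; omega
  · have hfQ : f ∈ Q K m n ^ (k * a) := hf.2
    have := pow_smul_top_le hk a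
    rw [← pow_mul] at this
    exact this (Submodule.smul_mem_smul hfQ trivial)

end Degrees

/-! ### Linear forms generating `Q` up to radical, and their least number -/

section LinearSystems

open MvPolynomial

theorem weight_bidegree_add (s : Fin m ⊕ Fin n →₀ ℕ) :
    (Finsupp.weight (bidegree m n) s).1 + (Finsupp.weight (bidegree m n) s).2 =
      Finsupp.degree s := by
  induction s using Finsupp.induction_linear with
  | zero => simp
  | add f g hf hg =>
    rw [map_add, map_add, Prod.fst_add, Prod.snd_add, Nat.cast_add, ← hf, ← hg]; ring
  | single a b => rcases a with a | a <;> simp [bidegree, Finsupp.weight_single]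

theorem component_mul_of_mem {z : S K m n} {δ : ℤ × ℤ} (hz : z ∈ component K m n δ) (f : S K m n)
    (d : ℤ × ℤ) : weightedHomogeneousComponent (bidegree m n) (d + δ) (f * z) =
      weightedHomogeneousComponent (bidegree m n) d f * z := by
  classical
  induction f using MvPolynomial.induction_on' with
  | monomial s c =>
    have h1 : monomial s c ∈ component K m n (Finsupp.weight (bidegree m n) s) :=
      isWeightedHomogeneous_monomial _ _ _ rfl
    have h2 : monomial s c * z ∈ component K m n (Finsupp.weight (bidegree m n) s + δ) :=
      IsWeightedHomogeneous.mul h1 hz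
    rw [weightedHomogeneousComponent_of_mem h1, weightedHomogeneousComponent_of_mem h2]
    by_cases h : d = Finsupp.weight (bidegree m n) s
    · rw [if_pos (by rw [h]), if_pos h]
    · rw [if_neg (fun h' => h (add_right_cancel h')), if_neg h, zero_mul]
  | add p q hp hq => rw [add_mul, map_add, hp, hq, map_add, add_mul]

theorem component_le_Q {y : S K m n} (hy : y ∈ component K m n (0, 1)) : y ∈ Q K m n := by
  have : (Set.range fun j : Fin n => (X (Sum.inr j) : S K m n)) = X '' Set.range Sum.inr := by
    rw [← Set.range_comp]; rfl
  rw [Q, this, mem_ideal_span_X_image]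
  intro s hs
  by_contra hcon
  push Not at hcon
  have hw := hy (mem_support_iff.1 hs)
  have : (Finsupp.weight (bidegree m n) s).2 = 0 := by
    rw [Finsupp.weight_apply, Finsupp.sum, Prod.snd_sum]
    refine Finset.sum_eq_zero fun i _ => ?_
    rcases i with i | i
    · simp [bidegree]
    · simp [hcon _ ⟨i, rfl⟩]
  rw [hw] at this
  exact one_ne_zero this

/-- `z` is a family of linear forms in the `y_j` generating `Q` up to radical modulo `J`. -/
structure IsLinearSystem (J : Ideal (S K m n)) {d : ℕ} (z : Fin d → S K m n) : Prop where
  mem : ∀ j, z j ∈ component K m n (0, 1)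
  le : Q K m n ≤ (J ⊔ Ideal.span (Set.range z)).radical

/-- The ideal `J` is bihomogeneous and contains `(x₁, …, x_m)`. -/
structure IsFiberIdeal (J : Ideal (S K m n)) : Prop where
  component_mem : ∀ f ∈ J, ∀ d, weightedHomogeneousComponent (bidegree m n) d f ∈ J
  xIdeal_le : xIdeal K m n ≤ J

theorem IsLinearSystem.exists_idealOfVars_pow_le {J : Ideal (S K m n)} (hJ : IsFiberIdeal J) {d : ℕ}
    {z : Fin d → S K m n} (hz : IsLinearSystem J z) :
    ∃ k, idealOfVars (Fin m ⊕ Fin n) K ^ k ≤ J ⊔ Ideal.span (Set.range z) := by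
  refine Ideal.exists_pow_le_of_le_radical_of_fg ?_ (IsNoetherian.noetherian _)
  rw [idealOfVars, Ideal.span_le]
  rintro _ ⟨i | j, rfl⟩
  · exact Ideal.le_radical (Ideal.mem_sup_left (hJ.xIdeal_le (Ideal.subset_span ⟨i, rfl⟩)))
  · exact hz.le (Ideal.subset_span ⟨j, rfl⟩)

/-- Graded Noether normalization: monomials of degree at most `k` generate, where `k` is such that
all monomials of degree at least `k` lie in `J + (z)`; higher monomials are rewritten modulo `J` by
the `z_l` with coefficients of lower degree. -/
theorem IsLinearSystem.finite {J : Ideal (S K m n)} (hJ : IsFiberIdeal J) {d : ℕ}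
    {z : Fin d → S K m n} (hz : IsLinearSystem J z) :
    ((Ideal.Quotient.mk J).comp (aeval z : MvPolynomial (Fin d) K →ₐ[K] S K m n).toRingHom).Finite
    := by
  classical
  obtain ⟨k, hk⟩ := hz.exists_idealOfVars_pow_le hJ
  let A := MvPolynomial (Fin d) K
  let ρ : A →+* S K m n ⧸ J := (Ideal.Quotient.mk J).comp (aeval z : A →ₐ[K] S K m n).toRingHom
  let : Algebra A (S K m n ⧸ J) := ρ.toAlgebra
  let : Module A (S K m n ⧸ J) := Algebra.toModule
  change Module.Finite A (S K m n ⧸ J)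
  have hsmul : ∀ (a : A) (f : S K m n),
      a • Ideal.Quotient.mk J f = Ideal.Quotient.mk J (aeval z a * f) := fun a f => by
    rw [Algebra.smul_def]; rw [map_mul]; rfl
  have hfin := Finsupp.finite_of_degree_le (σ := Fin m ⊕ Fin n) k
  let T : Set (S K m n ⧸ J) :=
    (fun s => Ideal.Quotient.mk J (monomial s 1)) '' {s | Finsupp.degree s ≤ k}
  let N : Submodule A (S K m n ⧸ J) := Submodule.span A T
  have hC : ∀ (c : K) (f : S K m n), Ideal.Quotient.mk J f ∈ N →
      Ideal.Quotient.mk J (C c * f) ∈ N := by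
    intro c f hf
    have := N.smul_mem (C c) hf
    rwa [hsmul, aeval_C] at this
  have hsum : ∀ f : S K m n, (∀ s ∈ f.support, Ideal.Quotient.mk J (monomial s 1) ∈ N) →
      Ideal.Quotient.mk J f ∈ N := by
    intro f hf
    rw [f.as_sum, map_sum]
    refine sum_mem fun s hs => ?_
    have := hC (coeff s f) _ (hf s hs)
    rwa [C_mul_monomial, mul_one] at this
  have key : ∀ e : ℕ, ∀ s : Fin m ⊕ Fin n →₀ ℕ, Finsupp.degree s = e →
      Ideal.Quotient.mk J (monomial s 1) ∈ N := by
    intro e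
    induction e with
    | zero => exact fun s hs => Submodule.subset_span ⟨s, by simp [hs], rfl⟩
    | succ e ih =>
      intro s hs
      by_cases hsk : Finsupp.degree s ≤ k
      · exact Submodule.subset_span ⟨s, hsk, rfl⟩
      have hmem : (monomial s (1 : K)) ∈ idealOfVars (Fin m ⊕ Fin n) K ^ k := by
        rw [mem_pow_idealOfVars_iff]
        intro t ht
        rw [mem_support_iff, coeff_monomial] at ht
        have : s = t := by by_contra h; exact ht (if_neg h)
        rw [← this]; omega
      obtain ⟨g, hg, h, hh, hgh⟩ := Submodule.mem_sup.1 (hk hmem)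
      obtain ⟨c, rfl⟩ := Ideal.mem_span_range_iff_exists_fun.1 hh
      set w := Finsupp.weight (bidegree m n) s with hw
      -- Passing to bidegree `w` keeps the first term in `J` and forces the coefficients of the `z
      -- l` to have total degree `e`.
      have hcomp : (monomial s (1 : K)) = weightedHomogeneousComponent (bidegree m n) w g +
          ∑ l, weightedHomogeneousComponent (bidegree m n) (w - (0, 1)) (c l) * z l := by
        have h1 : weightedHomogeneousComponent (bidegree m n) w (monomial s (1 : K)) =
            monomial s 1 := weightedHomogeneousComponent_eq_self
              (isWeightedHomogeneous_monomial _ _ _ rfl)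
        rw [← h1, ← hgh, map_add, map_sum]
        congr 1
        refine Finset.sum_congr rfl fun l _ => ?_
        rw [← component_mul_of_mem (hz.mem l), sub_add_cancel]
      rw [hcomp, map_add, map_sum,
        Ideal.Quotient.eq_zero_iff_mem.2 (hJ.component_mem g hg w), zero_add]
      refine sum_mem fun l _ => ?_
      have h2 : Ideal.Quotient.mk J
          (weightedHomogeneousComponent (bidegree m n) (w - (0, 1)) (c l)) ∈ N := by
        refine hsum _ fun t ht => ih t ?_
        have := weightedHomogeneousComponent_isWeightedHomogeneous (w := bidegree m n)
          (w - (0, 1)) (c l) (mem_support_iff.1 ht)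
        have h3 := weight_bidegree_add t
        have h4 := weight_bidegree_add s
        rw [this] at h3
        rw [← hw, hs] at h4
        simp only [Prod.fst_sub, Prod.snd_sub] at h3
        push_cast at h4
        omega
      have := N.smul_mem (X l) h2
      rwa [hsmul, aeval_X, mul_comm] at this
  have hT : T.Finite := hfin.image _
  refine ⟨⟨hT.toFinset, ?_⟩⟩
  rw [Set.Finite.coe_toFinset, eq_top_iff]
  intro x _
  obtain ⟨f, rfl⟩ := Ideal.Quotient.mk_surjective x
  exact hsum f fun s _ => key _ s rfl

theorem IsLinearSystem.exists_monic {J : Ideal (S K m n)} (hJ : IsFiberIdeal J) {d : ℕ}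
    {z : Fin d → S K m n} (hz : IsLinearSystem J z) (y : S K m n) :
    ∃ P : Polynomial (MvPolynomial (Fin d) K), P.Monic ∧
      P.eval₂ (aeval z : MvPolynomial (Fin d) K →ₐ[K] S K m n).toRingHom y ∈ J := by
  obtain ⟨P, hP, h⟩ := (hz.finite hJ).to_isIntegral (Ideal.Quotient.mk J y)
  refine ⟨P, hP, ?_⟩
  rw [← Polynomial.hom_eval₂] at h
  exact Ideal.Quotient.eq_zero_iff_mem.1 h

theorem IsLinearSystem.exists_dual {B : Type*} [AddCommGroup B] [Module (S K m n) B]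
    [Module.Finite (S K m n) B] (hJ : IsFiberIdeal (Module.annihilator (S K m n) B)) {d : ℕ}
    {z : Fin d → S K m n} (hz : IsLinearSystem (Module.annihilator (S K m n) B) z)
    (hinj : ∀ a : MvPolynomial (Fin d) K, aeval z a ∈ Module.annihilator (S K m n) B → a = 0) :
    ∃ φ : B →+ MvPolynomial (Fin d) K, (∀ j b, φ (z j • b) = X j * φ b) ∧ φ ≠ 0 := by
  let A := MvPolynomial (Fin d) K
  let J := Module.annihilator (S K m n) B
  let σ : A →+* S K m n := (aeval z : A →ₐ[K] S K m n).toRingHom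
  let : Algebra A (S K m n ⧸ J) := ((Ideal.Quotient.mk J).comp σ).toAlgebra
  let : Module A (S K m n ⧸ J) := Algebra.toModule
  let : Module (S K m n ⧸ J) B := Module.IsTorsionBySet.module (I := J)
    fun b a => (Module.mem_annihilator.1 a.2) b
  let : Module A B := Module.compHom B σ
  have hsmul : ∀ (a : A) (b : B), a • b = σ a • b := fun _ _ => rfl
  have hmk : ∀ (f : S K m n) (b : B), Ideal.Quotient.mk J f • b = f • b := fun _ _ => rfl
  have : IsScalarTower A (S K m n ⧸ J) B := by
    refine ⟨fun a x b => ?_⟩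
    obtain ⟨f, rfl⟩ := Ideal.Quotient.mk_surjective x
    rw [hmk, hsmul, ← mul_smul, ← hmk, Algebra.smul_def, map_mul]
    rfl
  have : IsScalarTower (S K m n) (S K m n ⧸ J) B := by
    refine ⟨fun a x b => ?_⟩
    obtain ⟨f, rfl⟩ := Ideal.Quotient.mk_surjective x
    rw [hmk, ← mul_smul, ← hmk]
    rfl
  have h1 : Module.Finite (S K m n ⧸ J) B := Module.Finite.of_restrictScalars_finite (S K m n) _ _
  have h2 : Module.Finite A (S K m n ⧸ J) := hz.finite hJ
  have h3 : Module.Finite A B := Module.Finite.trans (S K m n ⧸ J) B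
  obtain ⟨φ, hφ⟩ := exists_ne_zero_dual (A := A) (B := B)
    fun a ha => hinj a (Module.mem_annihilator.2 ha)
  refine ⟨φ.toAddMonoidHom, fun j b => ?_, fun h0 => hφ ?_⟩
  · have := φ.map_smul (X j) b
    rw [hsmul] at this
    change φ ((aeval z (X j : A)) • b) = _ at this
    rwa [aeval_X, smul_eq_mul] at this
  · ext1 b
    exact DFunLike.congr_fun h0 b

theorem aeval_mem_component {d : ℕ} {z : Fin d → S K m n} (hz : ∀ j, z j ∈ component K m n (0, 1))
    {e : ℕ} {f : MvPolynomial (Fin d) K} (hf : f.IsHomogeneous e) :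
    aeval z f ∈ component K m n (0, (e : ℤ)) := by
  rw [aeval_def, eval₂_eq]
  refine sum_mem fun s hs => ?_
  rw [algebraMap_eq]
  refine IsWeightedHomogeneous.C_mul ?_ _
  have hs' : Finsupp.degree s = e := by
    rw [Finsupp.degree_eq_weight_one]; exact hf (mem_support_iff.1 hs)
  have h1 := IsWeightedHomogeneous.prod s.support (fun i => z i ^ s i)
    (fun i => s i • ((0, 1) : ℤ × ℤ)) (fun i _ => IsWeightedHomogeneous.pow (hz i) (s i))
  rw [← Finset.sum_smul, ← Finsupp.degree_apply, hs'] at h1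
  simpa using h1

theorem IsFiberIdeal.aeval_homogeneousComponent_mem {J : Ideal (S K m n)} (hJ : IsFiberIdeal J)
    {d : ℕ} {z : Fin d → S K m n} (hz : ∀ j, z j ∈ component K m n (0, 1))
    {f : MvPolynomial (Fin d) K} (hf : aeval z f ∈ J) (e : ℕ) :
    aeval z (homogeneousComponent e f) ∈ J := by
  classical
  have h := hJ.component_mem _ hf (0, (e : ℤ))
  have hfe : ∀ i : ℕ, aeval z (homogeneousComponent i f) ∈ component K m n (0, (i : ℤ)) := fun i =>
    aeval_mem_component hz (homogeneousComponent_isHomogeneous i f)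
  have key : weightedHomogeneousComponent (bidegree m n) (0, (e : ℤ)) (aeval z f) =
      aeval z (homogeneousComponent e f) := by
    conv_lhs => rw [← sum_homogeneousComponent f, map_sum, map_sum]
    simp_rw [weightedHomogeneousComponent_of_mem (hfe _)]
    rw [Finset.sum_eq_single e]
    · rw [if_pos rfl]
    · intro i _ hi
      rw [if_neg]
      intro h'
      exact hi (by simpa using h'.symm)
    · intro he
      rw [if_pos rfl, homogeneousComponent_eq_zero, map_zero]
      simpa using he
  rwa [key] at h

theorem aeval_smul_of_isHomogeneous {A : Type*} [CommRing A] [Algebra K A] {d e : ℕ}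
    {f : MvPolynomial (Fin d) K} (hf : f.IsHomogeneous e) (c : Fin d → K) (t : A) :
    aeval (fun j => c j • t) f = eval c f • t ^ e := by
  rw [aeval_def, eval₂_eq, eval_eq, Finset.sum_smul]
  refine Finset.sum_congr rfl fun s hs => ?_
  have hs' : Finsupp.degree s = e := by
    rw [Finsupp.degree_eq_weight_one]; exact hf (mem_support_iff.1 hs)
  simp_rw [smul_pow, Algebra.smul_def (_ ^ _ : K)]
  rw [Finset.prod_mul_distrib, Finset.prod_pow_eq_pow_sum, ← Finsupp.degree_apply, hs',
    Algebra.smul_def, map_mul, map_prod, mul_assoc]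

/-- A relation may be taken to be a form `f`. With `f(c) ≠ 0` and `c i ≠ 0`, dividing out all `z j -
(c j / c i) z i` makes `z` proportional to `c`, so `f(z) ∈ J` says that `z i` is nilpotent there.
These differences, without the index `i`, are thus a shorter system. -/
theorem IsLinearSystem.exists_lt [Infinite K] {J : Ideal (S K m n)} (hJ : IsFiberIdeal J)
    (hJt : J ≠ ⊤) {d : ℕ} {z : Fin d → S K m n} (hz : IsLinearSystem J z)
    {a : MvPolynomial (Fin d) K} (ha : a ≠ 0) (haJ : aeval z a ∈ J) :
    ∃ e < d, ∃ z' : Fin e → S K m n, IsLinearSystem J z' := by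
  classical
  obtain ⟨e, he⟩ : ∃ e, homogeneousComponent e a ≠ 0 := by
    by_contra hcon
    push Not at hcon
    exact ha (by rw [← sum_homogeneousComponent a]; simp [hcon])
  set f := homogeneousComponent e a with hf
  have hfJ := hJ.aeval_homogeneousComponent_mem hz.mem haJ e
  have hfe : f.IsHomogeneous e := homogeneousComponent_isHomogeneous e a
  obtain ⟨c, hc⟩ : ∃ c, eval c f ≠ 0 := by
    by_contra hcon
    push Not at hcon
    exact he (MvPolynomial.funext fun x => by rw [hcon x, map_zero])
  have hunit : ∀ r : K, r ≠ 0 → algebraMap K (S K m n) r ∉ J := fun r hr h =>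
    hJt (Ideal.eq_top_of_isUnit_mem _ h ((isUnit_iff_ne_zero.2 hr).map _))
  -- If `c = 0`, then either `f` is a nonzero constant, which would put a unit in `J`, or `f` has
  -- positive degree and vanishes at `c`.
  obtain ⟨i, hi⟩ : ∃ i, c i ≠ 0 := by
    by_contra hcon
    push Not at hcon
    have h0 : c = 0 := _root_.funext hcon
    rcases Nat.eq_zero_or_pos e with rfl | hpos
    · have h1 : f = C (coeff 0 f) := by
        rw [hf, homogeneousComponent_zero, coeff_C, if_pos rfl]
      rw [h1, eval_C] at hc
      rw [← hf, h1, aeval_C] at hfJ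
      exact hunit _ hc hfJ
    · have := aeval_smul_of_isHomogeneous hfe c (0 : K)
      rw [zero_pow hpos.ne', smul_zero] at this
      apply hc
      rw [← this, h0]
      simp [aeval_def, eval₂_eq_eval_map]
  obtain ⟨d, rfl⟩ : ∃ d', d = d' + 1 := ⟨d - 1, by have := i.pos; omega⟩
  let z' : Fin (d + 1) → S K m n := fun j => z j - (c j / c i) • z i
  have hz'i : z' i = 0 := by simp [z', div_self hi]
  let I := J ⊔ Ideal.span (Set.range fun j => z' (i.succAbove j))
  have hz'I : ∀ j, z' j ∈ I := by
    intro j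
    rcases eq_or_ne j i with rfl | hj
    · rw [hz'i]; exact zero_mem _
    · obtain ⟨l, rfl⟩ := Fin.exists_succAbove_eq hj
      exact Ideal.mem_sup_right (Ideal.subset_span ⟨l, rfl⟩)
  have hpow : z i ^ e ∈ I := by
    have h1 : Ideal.Quotient.mkₐ K I (aeval z f) = 0 :=
      Ideal.Quotient.eq_zero_iff_mem.2 (Ideal.mem_sup_left hfJ)
    have h2 : ∀ j, Ideal.Quotient.mkₐ K I (z j) =
        c j • ((c i)⁻¹ • Ideal.Quotient.mkₐ K I (z i)) := by
      intro j
      have h3 : Ideal.Quotient.mkₐ K I (z' j) = 0 := Ideal.Quotient.eq_zero_iff_mem.2 (hz'I j)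
      rw [map_sub, map_smul, sub_eq_zero] at h3
      rw [h3, smul_smul, div_eq_mul_inv]
    have h4 : Ideal.Quotient.mkₐ K I (aeval z f) =
        aeval (fun j => Ideal.Quotient.mkₐ K I (z j)) f := by
      rw [← AlgHom.comp_apply, comp_aeval]
    rw [h4, _root_.funext h2, aeval_smul_of_isHomogeneous hfe, smul_pow, smul_smul, ← map_pow,
      ← map_smul] at h1
    have h5 : (eval c f * (c i)⁻¹ ^ e) • z i ^ e ∈ I := Ideal.Quotient.eq_zero_iff_mem.1 h1
    have hne : eval c f * (c i)⁻¹ ^ e ≠ 0 := mul_ne_zero hc (pow_ne_zero _ (inv_ne_zero hi))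
    have h6 := I.mul_mem_left (C (eval c f * (c i)⁻¹ ^ e)⁻¹) h5
    rwa [← smul_eq_C_mul, smul_smul, inv_mul_cancel₀ hne, one_smul] at h6
  have hzI : ∀ j, z j ∈ I.radical := by
    intro j
    have : z j = z' j + C (c j / c i) * z i := by
      simp only [z', smul_eq_C_mul]; ring
    rw [this]
    exact add_mem (Ideal.le_radical (hz'I j)) (Ideal.mul_mem_left _ _ ⟨e, hpow⟩)
  refine ⟨d, Nat.lt_succ_self d, fun j => z' (i.succAbove j), fun j => ?_, ?_⟩
  · exact Submodule.sub_mem _ (hz.mem _) (Submodule.smul_mem _ _ (hz.mem i))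
  · refine hz.le.trans ?_
    rw [← Ideal.radical_idem (J ⊔ Ideal.span (Set.range fun j => z' (i.succAbove j)))]
    refine Ideal.radical_mono (sup_le (le_sup_left.trans Ideal.le_radical) ?_)
    rw [Ideal.span_le]
    rintro _ ⟨j, rfl⟩
    exact hzI j

/-- The least number of linear forms in the `y_j` generating `Q` up to radical modulo `J`. -/
noncomputable def linearRank (J : Ideal (S K m n)) : ℕ :=
  sInf {d | ∃ z : Fin d → S K m n, IsLinearSystem J z}

theorem exists_isLinearSystem (J : Ideal (S K m n)) :
    ∃ z : Fin (linearRank J) → S K m n, IsLinearSystem J z := by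
  refine Nat.sInf_mem (s := {d | ∃ z : Fin d → S K m n, IsLinearSystem J z})
    ⟨n, fun j => X (Sum.inr j), fun j => X_inr_mem_component j, ?_⟩
  exact le_sup_right.trans Ideal.le_radical

theorem linearRank_le {J : Ideal (S K m n)} {d : ℕ} {z : Fin d → S K m n}
    (hz : IsLinearSystem J z) : linearRank J ≤ d :=
  Nat.sInf_le ⟨z, hz⟩

theorem IsLinearSystem.eq_zero_of_aeval_mem [Infinite K] {J : Ideal (S K m n)}
    (hJ : IsFiberIdeal J) (hJt : J ≠ ⊤) {d : ℕ} (hd : d ≤ linearRank J) {z : Fin d → S K m n}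
    (hz : IsLinearSystem J z) {a : MvPolynomial (Fin d) K} (haJ : aeval z a ∈ J) : a = 0 := by
  by_contra ha
  obtain ⟨e, he, z', hz'⟩ := hz.exists_lt hJ hJt ha haJ
  exact absurd (linearRank_le hz') (by omega)

/-- If the rank did not drop, a minimal system for `J` would stay algebraically independent modulo
`J'`. Then a prime over `J'` meets the polynomial ring only in zero, and it contains a minimal prime
`p` of `J` avoiding `y`; an integral equation of `y` modulo `J` yields a contradiction. -/
theorem linearRank_lt [Infinite K] {J J' : Ideal (S K m n)} (hJ : IsFiberIdeal J)
    (hJ' : IsFiberIdeal J') (hJt' : J' ≠ ⊤) (hJJ' : J ≤ J') {y : S K m n} (hy : y ∈ J')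
    (hyp : ∀ p ∈ J.minimalPrimes, ¬ Q K m n ≤ p → y ∉ p) (hpos : 0 < linearRank J) :
    linearRank J' < linearRank J := by
  classical
  by_contra hlt
  push Not at hlt
  obtain ⟨z, hz⟩ := exists_isLinearSystem J
  have hz' : IsLinearSystem J' z :=
    ⟨hz.mem, hz.le.trans (Ideal.radical_mono (sup_le_sup_right hJJ' _))⟩
  have hinj : ∀ a, aeval z a ∈ J' → a = 0 := fun a => hz'.eq_zero_of_aeval_mem hJ' hJt' hlt
  let σ : MvPolynomial (Fin (linearRank J)) K →+* S K m n :=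
    (aeval z : MvPolynomial (Fin (linearRank J)) K →ₐ[K] S K m n).toRingHom
  obtain ⟨p', hp', hJp', hdisj⟩ := Ideal.exists_le_prime_disjoint J'
    ((nonZeroDivisors (MvPolynomial (Fin (linearRank J)) K)).map σ) (by
      rw [Set.disjoint_left]
      rintro _ hx ⟨a, ha, rfl⟩
      exact nonZeroDivisors.ne_zero ha (hinj a hx))
  have hp'inj : ∀ a, σ a ∈ p' → a = 0 := by
    intro a ha
    by_contra h0
    exact Set.disjoint_left.1 hdisj ha ⟨a, mem_nonZeroDivisors_of_ne_zero h0, rfl⟩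
  obtain ⟨p, hp, hpp'⟩ := Ideal.exists_minimalPrimes_le (hJJ'.trans hJp')
  have hpprime : p.IsPrime := hp.1.1
  have hQp : ¬ Q K m n ≤ p := by
    intro hQ
    have : σ (X ⟨0, hpos⟩) ∈ p' := by
      change aeval z (X ⟨0, hpos⟩) ∈ p'
      rw [aeval_X]
      exact hpp' (hQ (component_le_Q (hz.mem _)))
    exact X_ne_zero _ (hp'inj _ this)
  have hyp' := hyp p hp hQp
  obtain ⟨P, hP, hPJ⟩ := hz.exists_monic hJ y
  -- As `y ∈ p'`, the constant term of an equation lies in `p'`, hence is zero; as `y ∉ p`, a factor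
  -- `y` cancels modulo `p`. The monic equation shrinks until it reads `1 ∈ p`.
  have key : ∀ (N : ℕ) (P : Polynomial (MvPolynomial (Fin (linearRank J)) K)), P.natDegree ≤ N →
      P.Monic → P.eval₂ σ y ∉ p := by
    intro N
    induction N with
    | zero =>
      intro P hN hP h
      rw [hP.natDegree_eq_zero.1 (by omega), Polynomial.eval₂_one] at h
      exact hpprime.ne_top ((Ideal.eq_top_iff_one _).2 h)
    | succ N ih =>
      intro P hN hP h
      by_cases h0 : P.natDegree = 0
      · exact ih P (by omega) hP h
      have hdiv := P.divX_mul_X_add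
      rw [← hdiv, Polynomial.eval₂_add, Polynomial.eval₂_mul, Polynomial.eval₂_X,
        Polynomial.eval₂_C] at h
      have hc : σ (P.coeff 0) ∈ p' :=
        (Ideal.add_mem_iff_right _ (Ideal.mul_mem_left _ _ (hJp' hy))).1 (hpp' h)
      rw [hp'inj _ hc, map_zero, add_zero] at h
      rcases hpprime.mem_or_mem h with h | h
      · refine ih P.divX ?_ ?_ h
        · rw [Polynomial.natDegree_divX_eq_natDegree_tsub_one]; omega
        · rw [Polynomial.Monic, Polynomial.leadingCoeff,
            Polynomial.natDegree_divX_eq_natDegree_tsub_one, Polynomial.coeff_divX,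
            Nat.sub_add_cancel (by omega)]
          exact hP
      · exact hyp' h
  exact key _ P le_rfl hP (hp.1.2 hPJ)

end LinearSystems

/-! ### Cohomological dimension as the linear rank of the fiber ideal -/

section FiberIdeal

variable (C : Type u) [AddCommGroup C] [Module (S K m n) C]

/-- The annihilator of `C / (x₁, …, x_m) C`. -/
noncomputable def fiberIdeal : Ideal (S K m n) :=
  Module.annihilator (S K m n) (C ⧸ (xIdeal K m n • ⊤ : Submodule (S K m n) C))

variable {C}

theorem mem_fiberIdeal {f : S K m n} :
    f ∈ fiberIdeal C ↔ ∀ c : C, f • c ∈ (xIdeal K m n • ⊤ : Submodule (S K m n) C) := by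
  rw [fiberIdeal, Module.mem_annihilator]
  constructor
  · intro h c
    rw [← Submodule.Quotient.mk_eq_zero, Submodule.Quotient.mk_smul]
    exact h _
  · intro h c
    obtain ⟨c, rfl⟩ := Submodule.Quotient.mk_surjective _ c
    rw [← Submodule.Quotient.mk_smul, Submodule.Quotient.mk_eq_zero]
    exact h c

theorem fiberIdeal_le_of_surjective {W : Type u} [AddCommGroup W] [Module (S K m n) W]
    {g : C →ₗ[S K m n] W} (hg : Function.Surjective g) :
    (fiberIdeal C : Ideal (S K m n)) ≤ fiberIdeal W := by
  intro f hf
  rw [mem_fiberIdeal] at hf ⊢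
  intro w
  obtain ⟨c, rfl⟩ := hg w
  have h1 := Submodule.mem_map_of_mem (f := g) (hf c)
  rw [Submodule.map_smul''] at h1
  rw [← map_smul]
  exact Submodule.smul_mono le_rfl le_top h1

variable {𝒞 : ℤ × ℤ → AddSubgroup C}

theorem IsBigrading.isBigrading_fiber (h : IsBigrading K m n 𝒞) :
    IsBigrading K m n (quotientBigrading 𝒞 (xIdeal K m n • ⊤ : Submodule (S K m n) C)) := by
  refine h.quotient (h.isBigradedSubmodule_span_smul_top ?_)
  rintro _ ⟨i, rfl⟩
  exact ⟨_, X_inl_mem_component i⟩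

theorem IsBigrading.isFiberIdeal (h : IsBigrading K m n 𝒞) :
    IsFiberIdeal (fiberIdeal C : Ideal (S K m n)) where
  component_mem _ hf d := h.isBigrading_fiber.component_mem_annihilator hf d
  xIdeal_le _ hf := mem_fiberIdeal.2 fun _ => Submodule.smul_mem_smul hf trivial

variable [Module.Finite (S K m n) C]

theorem IsBigrading.fiberIdeal_ne_top [Nontrivial C] (h : IsBigrading K m n 𝒞) :
    (fiberIdeal C : Ideal (S K m n)) ≠ ⊤ := by
  intro htop
  -- Nakayama with exponent `k = 0`: if `C = (x) C` then `C = 0`.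
  have h1 : Q K m n ^ 0 • (⊤ : Submodule (S K m n) C) ≤ xIdeal K m n • ⊤ := by
    intro c _
    have := mem_fiberIdeal.1 (htop ▸ trivial : (1 : S K m n) ∈ fiberIdeal C) c
    rwa [one_smul] at this
  obtain ⟨a, ha⟩ := h.exists_pow_smul_top_eq_bot h1
  rw [zero_mul, pow_zero, Ideal.one_eq_top, Submodule.top_smul] at ha
  exact top_ne_bot ha

/-- On `W = C/(z)C` some `Q ^ k` acts into `(x) W`, so a power of `Q` kills `W` by graded Nakayama.
The support of `W` is the zero locus of `Ann C + (z)`, which transfers this to the required radical.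
-/
theorem IsBigrading.isSystem (h : IsBigrading K m n 𝒞) {d : ℕ} {z : Fin d → S K m n}
    (hz : IsLinearSystem (fiberIdeal C) z) : IsSystem (Q K m n) z C := by
  let Z := Ideal.span (Set.range z)
  let W := C ⧸ (Z • ⊤ : Submodule (S K m n) C)
  have hW : IsBigrading K m n (quotientBigrading 𝒞 (Z • ⊤ : Submodule (S K m n) C)) := by
    refine h.quotient (h.isBigradedSubmodule_span_smul_top ?_)
    rintro _ ⟨j, rfl⟩
    exact ⟨_, hz.mem j⟩
  obtain ⟨k, hk⟩ := Ideal.exists_pow_le_of_le_radical_of_fg hz.le (IsNoetherian.noetherian _)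
  have hkW : Q K m n ^ k • (⊤ : Submodule (S K m n) W) ≤ xIdeal K m n • ⊤ := by
    rw [Submodule.smul_le]
    intro r hr w _
    obtain ⟨c, rfl⟩ := Submodule.Quotient.mk_surjective _ w
    obtain ⟨f, hf, g, hg, rfl⟩ := Submodule.mem_sup.1 (hk hr)
    have h1 : g • (Submodule.Quotient.mk c : W) = 0 := by
      rw [← Submodule.Quotient.mk_smul, Submodule.Quotient.mk_eq_zero]
      exact Submodule.smul_mem_smul hg trivial
    rw [add_smul, h1, add_zero]
    exact mem_fiberIdeal.1 (fiberIdeal_le_of_surjective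
      (Submodule.mkQ_surjective (Z • ⊤ : Submodule (S K m n) C)) hf) _
  obtain ⟨a, ha⟩ := hW.exists_pow_smul_top_eq_bot hkW
  have hQW : Q K m n ≤ (Module.annihilator (S K m n) W).radical := by
    intro r hr
    refine ⟨k * a, Module.mem_annihilator.2 fun w => ?_⟩
    rw [← Submodule.mem_bot (S K m n), ← ha]
    exact Submodule.smul_mem_smul (Ideal.pow_mem_pow hr _) trivial
  have hsupp := Module.support_quotient (M := C) Z
  rw [Module.support_eq_zeroLocus, Module.support_eq_zeroLocus, ← PrimeSpectrum.zeroLocus_sup,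
    PrimeSpectrum.zeroLocus_eq_iff] at hsupp
  intro c
  refine hQW.trans (hsupp.le.trans (Ideal.radical_mono (sup_le_sup_right ?_ _)))
  intro f hf
  exact (Ideal.mem_torsionOf_iff _ _).2 (Module.mem_annihilator.1 hf c)

theorem IsBigrading.localCohomologyVanishes_of_lt (h : IsBigrading K m n 𝒞) {i : ℕ}
    (hi : linearRank (fiberIdeal C : Ideal (S K m n)) < i) :
    LocalCohomologyVanishes (Q K m n) C i := by
  obtain ⟨z, hz⟩ := exists_isLinearSystem (fiberIdeal C : Ideal (S K m n))
  exact (h.isSystem hz).localCohomologyVanishes (fun j => component_le_Q (hz.mem j)) hi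

/-- A minimal system is algebraically independent modulo the fiber ideal, so `C/(x)C` has a nonzero
functional to the polynomial ring; its pullback to `C` detects the top cohomology. -/
theorem IsBigrading.not_localCohomologyVanishes [Infinite K] [Nontrivial C]
    (h : IsBigrading K m n 𝒞) :
    ¬ LocalCohomologyVanishes (Q K m n) C (linearRank (fiberIdeal C : Ideal (S K m n))) := by
  obtain ⟨z, hz⟩ := exists_isLinearSystem (fiberIdeal C : Ideal (S K m n))
  obtain ⟨φ, hφ, hne⟩ := hz.exists_dual h.isFiberIdeal
    fun a => hz.eq_zero_of_aeval_mem h.isFiberIdeal h.fiberIdeal_ne_top le_rfl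
  refine (h.isSystem hz).not_localCohomologyVanishes (fun j => component_le_Q (hz.mem j))
    (φ.comp (Submodule.mkQ _).toAddMonoidHom) (fun j c => hφ j (Submodule.Quotient.mk c))
    fun h0 => hne ?_
  ext1 x
  obtain ⟨c, rfl⟩ := Submodule.Quotient.mk_surjective _ x
  exact DFunLike.congr_fun h0 c

/-- Reduction of a relative Cohen--Macaulay module modulo a generic linear form. -/
theorem IsBigrading.localCohomologyVanishes_quotient [Infinite K] [Nontrivial C]
    (h : IsBigrading K m n 𝒞) {W : Type u} [AddCommGroup W] [Module (S K m n) W]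
    [Module.Finite (S K m n) W] {𝒲 : ℤ × ℤ → AddSubgroup W} (hW : IsBigrading K m n 𝒲) {q : ℕ}
    (hq : ∀ i ≠ q + 1, LocalCohomologyVanishes (Q K m n) C i) {y : S K m n} (hy : y ∈ Q K m n)
    (hyp : ∀ p ∈ (fiberIdeal C : Ideal (S K m n)).minimalPrimes, ¬ Q K m n ≤ p → y ∉ p)
    {g : C →ₗ[S K m n] W} (hinj : Function.Injective (LinearMap.lsmul (S K m n) C y))
    (hg : Function.Surjective g) (hex : Function.Exact (LinearMap.lsmul (S K m n) C y) g) :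
    (∀ i ≠ q, LocalCohomologyVanishes (Q K m n) W i) ∧
      ¬ LocalCohomologyVanishes (Q K m n) W q := by
  have hrank : linearRank (fiberIdeal C : Ideal (S K m n)) = q + 1 := by
    by_contra hne
    exact h.not_localCohomologyVanishes (hq _ hne)
  have hyW : ∀ w : W, y • w = 0 := by
    intro w
    obtain ⟨c, rfl⟩ := hg w
    rw [← map_smul]
    exact hex.apply_apply_eq_zero c
  refine ⟨fun i hi => ?_, fun hV => ?_⟩
  -- Degree `q + 1` is out of reach of the long exact sequence, since `H^{q+1}(C) ≠ 0`; there the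
  -- drop of the linear rank is used.
  · by_cases hi' : i = q + 1
    · subst hi'
      rcases subsingleton_or_nontrivial W with hs | hs
      · exact localCohomologyVanishes_of_bijective hy
          ⟨Function.injective_of_subsingleton _, fun w => ⟨w, Subsingleton.elim _ _⟩⟩
      · refine hW.localCohomologyVanishes_of_lt ?_
        rw [← hrank]
        refine linearRank_lt h.isFiberIdeal hW.isFiberIdeal hW.fiberIdeal_ne_top
          (fiberIdeal_le_of_surjective hg) (mem_fiberIdeal.2 fun w => ?_) hyp (by omega)
        rw [hyW]
        exact zero_mem _
    · exact LocalCohomologyVanishes.right hinj hg hex (hq i hi') (hq (i + 1) (by omega))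
  · have := LocalCohomologyVanishes.of_quotient hy hinj hg hex hV
    rw [← hrank] at this
    exact h.not_localCohomologyVanishes this

end FiberIdeal

/-- Since `S_(0,1)` generates `Q`, each `p` meets it in a proper subspace, and over an infinite
field finitely many of these do not cover it. -/
theorem exists_component_notMem [Infinite K] {P : Set (Ideal (S K m n))} (hP : P.Finite)
    (hQ : ∀ p ∈ P, ¬ Q K m n ≤ p) : ∃ y ∈ component K m n (0, 1), ∀ p ∈ P, y ∉ p := by
  classical
  let E : Ideal (S K m n) → Subspace K (component K m n (0, 1)) := fun p =>
    (p.restrictScalars K).comap (component K m n (0, 1)).subtype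
  have htop : ⊤ ∉ hP.toFinset.image E := by
    intro h
    obtain ⟨p, hp, hpE⟩ := Finset.mem_image.1 h
    refine hQ p (hP.mem_toFinset.1 hp) ?_
    rw [Q, Ideal.span_le]
    rintro _ ⟨j, rfl⟩
    have : (⟨_, X_inr_mem_component j⟩ : component K m n (0, 1)) ∈ E p := hpE ▸ trivial
    exact this
  obtain ⟨y, hy⟩ := (Set.ne_univ_iff_exists_notMem _).1
    (Subspace.biUnion_ne_univ_of_top_notMem htop)
  refine ⟨y, y.2, fun p hp hyp => hy ?_⟩
  exact Set.mem_biUnion (Finset.mem_coe.2 (Finset.mem_image_of_mem E (hP.mem_toFinset.2 hp))) hyp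

/-! ### The filtration induced on `M / yM` -/

section Chain

variable {M : Type u} [AddCommGroup M] [Module (S K m n) M] {r : ℕ}
  {F : Fin (r + 1) → Submodule (S K m n) M} {y : S K m n}

/-- Regularity on the factors forces `x` down the chain from `M` to `F i`, one step at a time. Hence
`yM ∩ F i = y (F i)`. -/
theorem mem_of_smul_mem_of_factor_regular (hmono : Monotone F) (htop : F (Fin.last r) = ⊤)
    (hy : ∀ i, IsSMulRegular (factor F i) y) {x : M} {i : Fin (r + 1)} (hx : y • x ∈ F i) :
    x ∈ F i := by
  have hstep : ∀ (i : Fin r) (x : M), x ∈ F i.succ → y • x ∈ F i.castSucc → x ∈ F i.castSucc := by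
    intro i x hx hyx
    have h0 : (Submodule.Quotient.mk ⟨x, hx⟩ : factor F i) = 0 := by
      refine hy i ?_
      change y • (Submodule.Quotient.mk ⟨x, hx⟩ : factor F i) = y • 0
      rw [smul_zero, ← Submodule.Quotient.mk_smul, Submodule.Quotient.mk_eq_zero]
      exact hyx
    exact (Submodule.Quotient.mk_eq_zero ((F i.castSucc).submoduleOf (F i.succ))).1 h0
  have key : ∀ j : Fin (r + 1), i ≤ j → x ∈ F j → x ∈ F i := by
    intro j
    induction j using Fin.induction with
    | zero => exact fun hi hxj => by rwa [Fin.le_zero_iff.1 hi]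
    | succ j ih =>
      intro hi hxj
      rcases eq_or_lt_of_le hi with rfl | hlt
      · exact hxj
      · have hij : i ≤ j.castSucc := Fin.le_castSucc_iff.2 hlt
        exact ih hij (hstep j x hxj (hmono hij hx))
  exact key (Fin.last r) (Fin.le_last i) (htop ▸ trivial)

/-- The chain induced on `M / yM`. -/
noncomputable abbrev quotientChain (F : Fin (r + 1) → Submodule (S K m n) M) (y : S K m n) :
    Fin (r + 1) → Submodule (S K m n) (M ⧸ (y • ⊤ : Submodule (S K m n) M)) :=
  fun i => (F i).map (Submodule.mkQ _)

/-- The surjection from a factor of a chain to a factor of the induced chain on `M / yM`. -/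
noncomputable def factorMap (F : Fin (r + 1) → Submodule (S K m n) M) (y : S K m n) (i : Fin r) :
    factor F i →ₗ[S K m n] factor (quotientChain F y) i :=
  Submodule.mapQ _ _ ((Submodule.mkQ (y • ⊤ : Submodule (S K m n) M)).submoduleMap (F i.succ))
    fun _ hx => Submodule.mem_map_of_mem (f := Submodule.mkQ _) hx

theorem factorMap_surjective (i : Fin r) : Function.Surjective (factorMap F y i) := by
  intro w
  obtain ⟨w, rfl⟩ := Submodule.Quotient.mk_surjective _ w
  obtain ⟨u, rfl⟩ := LinearMap.submoduleMap_surjective _ _ w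
  exact ⟨Submodule.Quotient.mk u, rfl⟩

/-- Identifies the new factor with the old one modulo `y`; `hF` is what lets an element of `yM`
lying in `F i.succ` be divided by `y` inside `F i.succ`. -/
theorem factorMap_exact (hmono : Monotone F)
    (hF : ∀ (i : Fin (r + 1)) (x : M), y • x ∈ F i → x ∈ F i) (i : Fin r) :
    Function.Exact (LinearMap.lsmul (S K m n) (factor F i) y) (factorMap F y i) := by
  intro x
  obtain ⟨u, rfl⟩ := Submodule.Quotient.mk_surjective _ x
  have hiff : factorMap F y i (Submodule.Quotient.mk u) = 0 ↔
      Submodule.mkQ (y • ⊤ : Submodule (S K m n) M) (u : M) ∈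
        (F i.castSucc).map (Submodule.mkQ (y • ⊤ : Submodule (S K m n) M)) :=
    Submodule.Quotient.mk_eq_zero ((quotientChain F y i.castSucc).submoduleOf _)
  rw [hiff]
  constructor
  · rintro ⟨v, hv, huv⟩
    have h1 : (u : M) - v ∈ (y • ⊤ : Submodule (S K m n) M) :=
      (Submodule.Quotient.eq _).1 huv.symm
    obtain ⟨w, -, hw⟩ := h1
    change y • w = (u : M) - v at hw
    have hwF : w ∈ F i.succ := by
      refine hF _ _ ?_
      rw [hw]
      exact sub_mem u.2 (hmono (Fin.castSucc_lt_succ).le hv)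
    refine ⟨Submodule.Quotient.mk ⟨w, hwF⟩, ?_⟩
    refine (Submodule.Quotient.eq ((F i.castSucc).submoduleOf (F i.succ))).2 ?_
    change y • w - (u : M) ∈ F i.castSucc
    rw [hw, sub_sub_cancel_left]
    exact neg_mem hv
  · rintro ⟨c, hc⟩
    obtain ⟨v, rfl⟩ := Submodule.Quotient.mk_surjective _ c
    have h1 : y • (v : M) - (u : M) ∈ F i.castSucc :=
      (Submodule.Quotient.eq ((F i.castSucc).submoduleOf (F i.succ))).1 hc
    refine ⟨(u : M) - y • (v : M), by rw [← neg_sub]; exact neg_mem h1, ?_⟩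
    rw [map_sub, sub_eq_self]
    exact (Submodule.Quotient.mk_eq_zero _).2 (Submodule.smul_mem_pointwise_smul _ _ _ trivial)

/-- Each concentration degree falls from `q i + 1` to `q i`. The uniform shift preserves their
strict order, and nonvanishing keeps the inclusions strict. -/
theorem IsCMFiltration.quotient [Infinite K] [Module.Finite (S K m n) M]
    {ℳ : ℤ × ℤ → AddSubgroup M} (hℳ : IsBigrading K m n ℳ) (hF : IsCMFiltration ℳ F)
    {q : Fin r → ℕ} (hq : ∀ i, IsConcentrated (Q K m n) (factor F i) (q i + 1))
    (hy : y ∈ component K m n (0, 1)) (hreg : ∀ i, IsSMulRegular (factor F i) y)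
    (hyp : ∀ i, ∀ p ∈ (fiberIdeal (factor F i) : Ideal (S K m n)).minimalPrimes,
      ¬ Q K m n ≤ p → y ∉ p) :
    IsCMFiltration (quotientBigrading ℳ (y • ⊤ : Submodule (S K m n) M)) (quotientChain F y) := by
  have hmono : Monotone F := (Fin.strictMono_iff_lt_succ.2 hF.strict).monotone
  have hmono' : Monotone (quotientChain F y) := fun i j hij => Submodule.map_mono (hmono hij)
  have hbig := fun i => (hF.bigraded i).map_mkQ (y • ⊤ : Submodule (S K m n) M)
  have hconc : ∀ i, IsConcentrated (Q K m n) (factor (quotientChain F y) i) (q i) := by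
    intro i
    have := (hq i).nontrivial
    have hC := (hℳ.sub (hF.bigraded i.succ)).quotient
      ((hF.bigraded i.castSucc).submoduleOf (hF.strict i).le)
    have hW := ((hℳ.quotient (hℳ.isBigradedSubmodule_smul_top hy)).sub (hbig i.succ)).quotient
      ((hbig i.castSucc).submoduleOf (hmono' (Fin.castSucc_lt_succ).le))
    have := hC.localCohomologyVanishes_quotient hW (hq i).vanishes (component_le_Q hy) (hyp i)
      (hreg i) (factorMap_surjective i)
      (factorMap_exact hmono (fun _ _ => mem_of_smul_mem_of_factor_regular hmono hF.top hreg) i)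
    exact ⟨this.1, this.2⟩
  refine ⟨?_, ?_, fun i => lt_of_le_of_ne (hmono' (Fin.castSucc_lt_succ).le) fun heq => ?_, hbig,
    fun i => (hconc i).isRelativeCM, fun i => ?_, fun i j hij => ?_⟩
  · rw [quotientChain, hF.bot, Submodule.map_bot]
  · rw [quotientChain, hF.top, Submodule.map_top, Submodule.range_mkQ]
  · refine not_subsingleton_iff_nontrivial.2 (hconc i).nontrivial ?_
    rw [Submodule.Quotient.subsingleton_iff, Submodule.submoduleOf_eq_top, heq]
  · rw [(hconc i).cd_eq]
    exact_mod_cast Nat.zero_le (q i)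
  · have := hF.cd_strictMono hij
    simp only [(hq _).cd_eq, (hconc _).cd_eq] at this ⊢
    norm_cast at this ⊢
    omega

theorem IsCMFiltration.exists_isConcentrated {ℳ : ℤ × ℤ → AddSubgroup M}
    (hF : IsCMFiltration ℳ F) (hgrade : 0 < grade (Q K m n) M) :
    ∃ q : Fin r → ℕ, ∀ i, IsConcentrated (Q K m n) (factor F i) (q i + 1) := by
  obtain ⟨a, haQ, ha⟩ := exists_isSMulRegular_of_grade_pos hgrade
  choose q hq using fun i => (hF.relativeCM i).exists_isConcentrated (hF.cd_nonneg i)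
  -- Only the bottom factor is a submodule of `M`, where the regular element excludes degree zero;
  -- the order of the degrees settles the others.
  have hpos : ∀ i, 0 < q i := by
    intro i
    obtain ⟨r, rfl⟩ : ∃ r', r = r' + 1 := ⟨r - 1, by have := i.pos; omega⟩
    have h0 : 0 < q 0 := by
      refine Nat.pos_of_ne_zero fun h0 => ?_
      have hV := (hq 0).not_vanishes
      rw [h0] at hV
      refine hV (localCohomologyVanishes_zero_of_isSMulRegular haQ ?_)
      intro u v huv
      obtain ⟨u, rfl⟩ := Submodule.Quotient.mk_surjective _ u
      obtain ⟨v, rfl⟩ := Submodule.Quotient.mk_surjective _ v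
      have h1 : a • (u : M) - a • (v : M) ∈ F (Fin.castSucc 0) :=
        (Submodule.Quotient.eq ((F (Fin.castSucc 0)).submoduleOf (F (Fin.succ 0)))).1 huv
      rw [Fin.castSucc_zero, hF.bot, Submodule.mem_bot, sub_eq_zero] at h1
      rw [Subtype.ext (ha h1)]
    rcases eq_or_lt_of_le (Fin.zero_le i) with rfl | hi
    · exact h0
    · have := hF.cd_strictMono hi
      simp only [(hq _).cd_eq] at this
      norm_cast at this
      omega
  refine ⟨fun i => q i - 1, fun i => ?_⟩
  rw [Nat.sub_add_cancel (hpos i)]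
  exact hq i

end Chain

/-- A generic linear form in the `y_j` is regular on `M` and on the factors of a Cohen--Macaulay
filtration, and the filtration descends to the quotient. -/
theorem IsSequentiallyCM.exists_component_quotient [Infinite K] {M : Type u} [AddCommGroup M]
    [Module (S K m n) M] [Module.Finite (S K m n) M] {ℳ : ℤ × ℤ → AddSubgroup M}
    (hℳ : IsBigrading K m n ℳ) (hgrade : 0 < grade (Q K m n) M)
    (hM : IsSequentiallyCM K m n ℳ) :
    ∃ y ∈ component K m n (0, 1), IsSMulRegular M y ∧
      IsSequentiallyCM K m n (quotientBigrading ℳ (y • (⊤ : Submodule (S K m n) M))) := by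
  obtain ⟨r, F, hF⟩ := hM
  obtain ⟨q, hq⟩ := hF.exists_isConcentrated hgrade
  -- Avoiding the associated primes gives regularity on the factors; avoiding the listed minimal
  -- primes makes the linear ranks drop. No associated prime contains `Q`, because `H^0_Q` of each
  -- factor is zero.
  let P : Set (Ideal (S K m n)) := ⋃ i, associatedPrimes (S K m n) (factor F i) ∪
    {p ∈ (fiberIdeal (factor F i) : Ideal (S K m n)).minimalPrimes | ¬ Q K m n ≤ p}
  have hP : P.Finite := Set.finite_iUnion fun i => (associatedPrimes.finite _ _).union
    ((Ideal.finite_minimalPrimes_of_isNoetherianRing _ _).subset (Set.sep_subset _ _))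
  have hPQ : ∀ p ∈ P, ¬ Q K m n ≤ p := by
    intro p hp
    obtain ⟨i, hp | hp⟩ := Set.mem_iUnion.1 hp
    · exact not_le_of_mem_associatedPrimes ((hq i).vanishes 0 (by omega)) hp
    · exact hp.2
  obtain ⟨y, hy, hyP⟩ := exists_component_notMem hP hPQ
  have hreg : ∀ i, IsSMulRegular (factor F i) y := by
    intro i
    by_contra hcon
    have h1 : y ∈ ⋃ p ∈ associatedPrimes (S K m n) (factor F i), (p : Set (S K m n)) := by
      rw [biUnion_associatedPrimes_eq_compl_regular]
      exact hcon
    obtain ⟨p, hp, hyp⟩ := Set.mem_iUnion₂.1 h1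
    exact hyP p (Set.mem_iUnion.2 ⟨i, Or.inl hp⟩) hyp
  have hmono : Monotone F := (Fin.strictMono_iff_lt_succ.2 hF.strict).monotone
  refine ⟨y, hy, fun u v huv => ?_, r, quotientChain F y,
    hF.quotient hℳ hq hy hreg fun i p hp hQp => hyP p (Set.mem_iUnion.2 ⟨i, Or.inr ⟨hp, hQp⟩⟩)⟩
  have h1 : y • (u - v) ∈ F 0 := by
    rw [smul_sub, sub_eq_zero.2 huv]
    exact zero_mem _
  have h2 := mem_of_smul_mem_of_factor_regular hmono hF.top hreg h1
  rwa [hF.bot, Submodule.mem_bot, sub_eq_zero] at h2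

end Bigraded

end BigradedCM

theorem mainTheorem5 (K : Type u) [Field K] [Infinite K] (m n : ℕ)
    (M : Type u) [AddCommGroup M] [Module (BigradedCM.S K m n) M]
    [Module.Finite (BigradedCM.S K m n) M]
    (ℳ : ℤ × ℤ → AddSubgroup M) (hℳ : BigradedCM.IsBigrading K m n ℳ)
    (hgrade : 0 < BigradedCM.grade (BigradedCM.Q K m n) M)
    (hM : BigradedCM.IsSequentiallyCM K m n ℳ) :
    ∃ y : BigradedCM.S K m n,
      y ∈ BigradedCM.Q K m n ∧
      y ∈ BigradedCM.component K m n (0, 1) ∧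
      IsSMulRegular M y ∧
      BigradedCM.IsSequentiallyCM K m n
        (BigradedCM.quotientBigrading ℳ (y • (⊤ : Submodule (BigradedCM.S K m n) M))) := by
  obtain ⟨y, hy, hreg, hCM⟩ := hM.exists_component_quotient hℳ hgrade
  exact ⟨y, BigradedCM.component_le_Q hy, hy, hreg, hCM⟩
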